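/- A digraph is a finite directed graph without loops. In a strongly connected digraph $\Gamma$, let $\partial(x,y)$ be the length of a shortest directed path from $x$ to $y$, put $\widetilde\partial(x,y)=(\partial(x,y),\partial(y,x))$, and let $\widetilde\partial(\Gamma)$ be the set of all values of $\widetilde\partial$. The digraph $\Gamma$ is called weakly distance-regular if it is strongly connected and, for all $\tilde i,\tilde j,\tilde h\in\widetilde\partial(\Gamma)$ and all vertices $x,y$ with $\widetilde\partial(x,y)=\tilde h$, the number of vertices $z$ with $\widetilde\partial(x,z)=\tilde i$ and $\widetilde\partial(z,y)=\tilde j$ depends only on $\tilde h,\tilde i,\tilde j$. It has valency $3$ if every vertex has exactly three out-neighbours. Its girth is the length of a shortest circuit. An arc $(u,v)$ is of type $(1,r)$ if $\partial(v,u)=r$. For a finite group $G$ and a subset $S\subseteq G$ not containing the identity, $\mathrm{Cay}(G,S)$ is the digraph with vertex set $G$ and arcs $(x,sx)$, $x\in G$, $s\in S$. For integers $q>2$, $s>2$ and $\max\{1,q-s+2\}\le k\le q$, let $\Gamma_{q,s,k}$ be the digraph with vertex set $\mathbb{Z}_q\times\mathbb{Z}_s$ whose arcs are $$((a,b),(a+1,b)),\quad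 ((a,c),(a,c+1)),\quad ((a,d),(a+1,d-1)),\quad ((a,s-1),(a-k+1,0)),\quad ((a,0),(a+k,s-1)),$$ where $a\in\mathbb{Z}_q$ and $b,c,d\in\mathbb{Z}_s$ with $c\ne s-1$ and $d\ne 0$. **Theorem.** Let $\Gamma$ be a weakly distance-regular digraph of valency $3$ and girth greater than $2$ whose arcs are of exactly two types. Then $\Gamma$ is isomorphic to one of the following digraphs: (i) $\mathrm{Cay}(\mathbb{Z}_4\times\mathbb{Z}_g,\{(0,1),(2,1),(1,0)\})$, where $g=3$ or $g\ge 5$; (ii) $\Gamma_{q,2mq,1}$, $\Gamma_{q,mq+2,q}$ or $\Gamma_{q,\,2mq-2q+2t,\,q+1-t}$, where $q\ge 3$, $m\ge 1$ and $2\le t\le q-1$. -/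

import Mathlib

namespace Digraph

variable {V W : Type*}

/-- There is a path `(u = w₀, w₁, …, w_r = v)` of length `r` from `u` to `v`. -/
def HasPath (G : Digraph V) (r : ℕ) (u v : V) : Prop :=
  ∃ w : ℕ → V, w 0 = u ∧ w r = v ∧ ∀ t < r, G.Adj (w t) (w (t + 1))

/-- Any vertex can be reached from any other vertex. -/
def StronglyConnected (G : Digraph V) : Prop :=
  ∀ x y : V, x ≠ y → ∃ r, G.HasPath r x y

/-- The distance `∂(x, y)`, the length of a shortest path from `x` to `y`. (It is only used for
strongly connected digraphs, where a path exists.) -/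
noncomputable def dist (G : Digraph V) (x y : V) : ℕ :=
  sInf {r | G.HasPath r x y}

/-- The two-way distance `∂̃(x, y) = (∂(x, y), ∂(y, x))`. -/
noncomputable def twoWayDist (G : Digraph V) (x y : V) : ℕ × ℕ :=
  (G.dist x y, G.dist y x)

/-- The set `∂̃(Γ)` of all two-way distances that occur. -/
def twoWayDistSet (G : Digraph V) : Set (ℕ × ℕ) :=
  {i | ∃ x y, G.twoWayDist x y = i}

/-- The set `P_{i,j}(x, y)` of all `z` with `∂̃(x, z) = i` and `∂̃(z, y) = j`. -/
def pathSet (G : Digraph V) (i j : ℕ × ℕ) (x y : V) : Set V :=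
  {z | G.twoWayDist x z = i ∧ G.twoWayDist z y = j}

/-- Weakly distance-regular: strongly connected, and for all `i, j ∈ ∂̃(Γ)` the number
`|P_{i,j}(x, y)|` depends only on `∂̃(x, y)`, `i` and `j`. -/
def IsWeaklyDistanceRegular (G : Digraph V) : Prop :=
  G.StronglyConnected ∧
    ∀ i ∈ G.twoWayDistSet, ∀ j ∈ G.twoWayDistSet, ∀ x y x' y' : V,
      G.twoWayDist x y = G.twoWayDist x' y' →
        (G.pathSet i j x y).ncard = (G.pathSet i j x' y').ncard

/-- Every vertex has exactly `k` out-neighbours. -/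
def HasValency (G : Digraph V) (k : ℕ) : Prop :=
  ∀ x : V, {y | G.Adj x y}.ncard = k

/-- `(w 0, …, w (r - 1))` is a circuit of length `r`: a path with `∂(w (r - 1), w 0) = 1`. -/
def IsCircuit (G : Digraph V) (r : ℕ) (w : ℕ → V) : Prop :=
  1 ≤ r ∧ (∀ t, t + 1 < r → G.Adj (w t) (w (t + 1))) ∧ G.dist (w (r - 1)) (w 0) = 1

/-- The length of a shortest circuit (`⊤` if there is no circuit). -/
noncomputable def girth (G : Digraph V) : ℕ∞ :=
  ⨅ r ∈ {r : ℕ | ∃ w, G.IsCircuit r w}, (r : ℕ∞)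

/-- The set of types of arcs: an arc `(u, v)` has type `(1, r)` where `r = ∂(v, u)`. -/
def arcTypes (G : Digraph V) : Set (ℕ × ℕ) :=
  {i | ∃ u v, G.Adj u v ∧ i = (1, G.dist v u)}

/-- Isomorphism of digraphs: a bijection preserving arcs in both directions. -/
def IsIsomorphic (G : Digraph V) (H : Digraph W) : Prop :=
  Nonempty (G.Adj ≃r H.Adj)

/-- The Cayley digraph of an additive group: the arcs are the pairs `(x, s + x)` with `s ∈ S`. -/
def addCayley (A : Type*) [AddGroup A] (S : Set A) : Digraph A where
  Adj x y := ∃ s ∈ S, y = s + x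

/-- The digraph `Γ_{q,s,k}` on `ℤ_q × ℤ_s`. It is considered for `q > 2`, `s > 2` and
`max {1, q - s + 2} ≤ k ≤ q`. In `ZMod s` the residue class of `s - 1` is `-1`. -/
def gammaDigraph (q s k : ℕ) : Digraph (ZMod q × ZMod s) where
  Adj x y :=
    y = (x.1 + 1, x.2) ∨
    (x.2 ≠ -1 ∧ y = (x.1, x.2 + 1)) ∨
    (x.2 ≠ 0 ∧ y = (x.1 + 1, x.2 - 1)) ∨
    (x.2 = -1 ∧ y = (x.1 - (k : ZMod q) + 1, 0)) ∨
    (x.2 = 0 ∧ y = (x.1 + (k : ZMod q), -1))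

end Digraph

/-!
A weakly distance-regular digraph of valency 3 whose arcs have exactly two types has one arc type
of valency 1 and one of valency 2. The first is the graph of a permutation `σ`; write `B` for the
second (`IsShiftFork`, `exists_isShiftFork`). Weak distance-regularity says that relations defined
from `σ` and `B` by composition depend on the two-way distance only (`Coherent`). Comparing the
return distances of a step of `σ` followed by one of `B`, and conversely, shows that `σ` is an
automorphism of `B` (`fork_shift`). So a path is a number of steps of `σ` together with a walk along
`B`, and everything is governed by the pairs `(i, j)` for which `i` steps of `σ` and `j` steps of
`B` close up (`ClosedShape`).

**A step of `σ` is never two steps of `B`.** Then the shortest closed walks along `B` alone are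
shorter than the closed walks that use both types of arcs (`exists_isPureLength_lt`).
If two vertices share both their out-neighbours along `B`, the vertices fall into pairs of twins;
the twin of `x` turns out to be `σ (σ x)` (`twin_eq_shift_shift`), so `σ` has order 4, and `Γ` is
the Cayley digraph on `ℤ₄ × ℤ_l`, where `l` is the length of the shortest closed walks along `B`
(`isIsomorphic_addCayley`); `l = 4` would make the two types of arcs equal (`pure_ne_four`).
If there are no twins, the out-neighbours of a vertex have a common out-neighbour, every shortest
closed walk along `B` avoids it and is straight in this sense, and comparing such walks
with the shortest mixed closed walks gives a contradiction (`false_of_noTwins`).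

**Some step of `σ` is two steps of `B`.** Then every arc `(x, y)` of `B` gives an arc `(y, σ x)`.
Following the other arc of `B` each time gives a sequence `x` indexed by `ℤ` whose
`σ`-translates are all the vertices, with a period `x (c + s) = σ ^ e (x c)` (`IsUnfolding`).
Distances can be computed from the parameters `n = orderOf σ`, `s`, `e`, and the pairs of vertices
joined by `j` steps in one direction along the sequence can be counted coherently
(`straightCount_unfolding`). The latter gives `n ∣ s - 2 * e` (`dvd_sub`), and comparing two
explicit distances settles the case of odd quotient (`dvd_sub_one_of_odd`). What remains are exactly
the parameters of the three families of digraphs `gammaDigraph`.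
-/

/-! ### Paths and distances -/

namespace Digraph

section Paths

variable {V : Type*} {Γ : Digraph V}

theorem hasPath_zero {x y : V} : Γ.HasPath 0 x y ↔ x = y := by
  constructor
  · rintro ⟨w, rfl, h, -⟩
    exact h
  · rintro rfl
    exact ⟨fun _ => x, rfl, rfl, by simp⟩

theorem hasPath_succ {r : ℕ} {x y : V} :
    Γ.HasPath (r + 1) x y ↔ ∃ z, Γ.Adj x z ∧ Γ.HasPath r z y := by
  constructor
  · rintro ⟨w, rfl, rfl, h⟩
    exact ⟨w 1, h 0 (by omega), fun t => w (t + 1), rfl, rfl, fun t ht => h (t + 1) (by omega)⟩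
  · rintro ⟨z, hz, w, rfl, rfl, h⟩
    refine ⟨fun t => Nat.casesOn t x w, rfl, rfl, fun t ht => ?_⟩
    cases t with
    | zero => exact hz
    | succ t => exact h t (by omega)

theorem HasPath.trans {a b : ℕ} {x y z : V} (h₁ : Γ.HasPath a x y) (h₂ : Γ.HasPath b y z) :
    Γ.HasPath (a + b) x z := by
  induction a generalizing x with
  | zero => rw [hasPath_zero] at h₁; subst h₁; simpa using h₂
  | succ a ih =>
    obtain ⟨u, hu, h⟩ := hasPath_succ.1 h₁
    rw [Nat.add_right_comm]
    exact hasPath_succ.2 ⟨u, hu, ih h⟩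

theorem Adj.hasPath {x y : V} (h : Γ.Adj x y) : Γ.HasPath 1 x y :=
  hasPath_succ.2 ⟨y, h, hasPath_zero.2 rfl⟩

theorem HasPath.dist_le {r : ℕ} {x y : V} (h : Γ.HasPath r x y) : Γ.dist x y ≤ r :=
  Nat.sInf_le h

theorem StronglyConnected.hasPath_dist (h : Γ.StronglyConnected) (x y : V) :
    Γ.HasPath (Γ.dist x y) x y := by
  have hne : {r | Γ.HasPath r x y}.Nonempty := by
    by_cases hxy : x = y
    · exact ⟨0, hasPath_zero.2 hxy⟩
    · exact h x y hxy
  exact Nat.sInf_mem hne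

theorem dist_self (x : V) : Γ.dist x x = 0 :=
  Nat.le_zero.1 (HasPath.dist_le (hasPath_zero.2 rfl))

theorem StronglyConnected.eq_of_dist_eq_zero (h : Γ.StronglyConnected) {x y : V}
    (hxy : Γ.dist x y = 0) : x = y :=
  hasPath_zero.1 (hxy ▸ h.hasPath_dist x y)

theorem StronglyConnected.adj_of_dist_eq_one (h : Γ.StronglyConnected) {x y : V}
    (hxy : Γ.dist x y = 1) : Γ.Adj x y := by
  have h1 : Γ.HasPath 1 x y := hxy ▸ h.hasPath_dist x y
  obtain ⟨z, hz, hzy⟩ := hasPath_succ.1 h1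
  rwa [hasPath_zero.1 hzy] at hz

theorem StronglyConnected.dist_eq_one (h : Γ.StronglyConnected) {x y : V}
    (hxy : Γ.Adj x y) (hne : x ≠ y) : Γ.dist x y = 1 := by
  have h1 := hxy.hasPath.dist_le
  have h2 : Γ.dist x y ≠ 0 := fun h0 => hne (h.eq_of_dist_eq_zero h0)
  omega

theorem twoWayDist_swap {x y x' y' : V} (h : Γ.twoWayDist x y = Γ.twoWayDist x' y') :
    Γ.twoWayDist y x = Γ.twoWayDist y' x' := by
  simp only [twoWayDist, Prod.mk.injEq] at h ⊢
  exact h.symm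

theorem twoWayDist_self (x : V) : Γ.twoWayDist x x = (0, 0) := by
  simp [twoWayDist, dist_self]

theorem StronglyConnected.eq_of_twoWayDist (h : Γ.StronglyConnected) {x y u : V}
    (hxy : Γ.twoWayDist x y = Γ.twoWayDist u u) : x = y := by
  rw [twoWayDist_self] at hxy
  exact h.eq_of_dist_eq_zero (congrArg Prod.fst hxy)

end Paths

/-! ### Coherent relations -/

section Coherent

variable {V : Type*} {Γ : Digraph V}

/-- In a weakly distance-regular digraph, two pairs at the same two-way distance are related by a
permutation matching the ways in which third vertices complete them to triangles. -/
theorem IsWeaklyDistanceRegular.exists_perm [Finite V] (h : Γ.IsWeaklyDistanceRegular)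
    {x y x' y' : V} (hxy : Γ.twoWayDist x y = Γ.twoWayDist x' y') :
    ∃ φ : Equiv.Perm V, ∀ z, Γ.twoWayDist x' (φ z) = Γ.twoWayDist x z ∧
      Γ.twoWayDist (φ z) y' = Γ.twoWayDist z y := by
  classical
  let f : V → (ℕ × ℕ) × (ℕ × ℕ) := fun z => (Γ.twoWayDist x z, Γ.twoWayDist z y)
  let f' : V → (ℕ × ℕ) × (ℕ × ℕ) := fun z => (Γ.twoWayDist x' z, Γ.twoWayDist z y')
  have hcard : ∀ k, Nat.card {z // f z = k} = Nat.card {z // f' z = k} := by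
    rintro ⟨i, j⟩
    have e1 : {z | f z = (i, j)} = Γ.pathSet i j x y := by
      ext z; simp [f, pathSet]
    have e2 : {z | f' z = (i, j)} = Γ.pathSet i j x' y' := by
      ext z; simp [f', pathSet]
    have key : (Γ.pathSet i j x y).ncard = (Γ.pathSet i j x' y').ncard := by
      by_cases hi : i ∈ Γ.twoWayDistSet
      · by_cases hj : j ∈ Γ.twoWayDistSet
        · exact h.2 i hi j hj x y x' y' hxy
        · have : ∀ u v, Γ.pathSet i j u v = ∅ := fun u v =>
            Set.eq_empty_of_forall_notMem fun z hz => hj ⟨z, v, hz.2⟩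
          rw [this, this]
      · have : ∀ u v, Γ.pathSet i j u v = ∅ := fun u v =>
          Set.eq_empty_of_forall_notMem fun z hz => hi ⟨u, z, hz.1⟩
        rw [this, this]
    rw [← e1, ← e2] at key
    exact key
  have hequiv : ∀ k, Nonempty ({z // f z = k} ≃ {z // f' z = k}) := fun k =>
    ⟨(Finite.card_eq.1 (hcard k)).some⟩
  let φ : V ≃ V := (Equiv.sigmaFiberEquiv f).symm.trans
    ((Equiv.sigmaCongrRight fun k => (hequiv k).some).trans (Equiv.sigmaFiberEquiv f'))
  refine ⟨φ, fun z => ?_⟩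
  have hφ : f' (φ z) = f z := ((hequiv (f z)).some ⟨z, rfl⟩).2
  exact ⟨congrArg Prod.fst hφ, congrArg Prod.snd hφ⟩

/-- A relation is coherent if it only depends on the two-way distance, that is, if it is a union
of relations of the scheme attached to the digraph. -/
def Coherent (Γ : Digraph V) (P : V → V → Prop) : Prop :=
  ∀ ⦃x y x' y' : V⦄, Γ.twoWayDist x y = Γ.twoWayDist x' y' → P x y → P x' y'

theorem coherent_twoWayDist (i : ℕ × ℕ) : Γ.Coherent fun x y => Γ.twoWayDist x y = i :=
  fun _ _ _ _ h hi => h.symm.trans hi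

theorem Coherent.swap {P : V → V → Prop} (hP : Γ.Coherent P) : Γ.Coherent fun x y => P y x :=
  fun _ _ _ _ h => hP (twoWayDist_swap h)

theorem Coherent.comp [Finite V] (h : Γ.IsWeaklyDistanceRegular) {P Q : V → V → Prop}
    (hP : Γ.Coherent P) (hQ : Γ.Coherent Q) : Γ.Coherent fun x y => ∃ z, P x z ∧ Q z y := by
  rintro x y x' y' hxy ⟨z, hxz, hzy⟩
  obtain ⟨φ, hφ⟩ := h.exists_perm hxy
  exact ⟨φ z, hP (hφ z).1.symm hxz, hQ (hφ z).2.symm hzy⟩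

theorem Coherent.ncard_eq [Finite V] (h : Γ.IsWeaklyDistanceRegular) {P Q : V → V → Prop}
    (hP : Γ.Coherent P) (hQ : Γ.Coherent Q) {x y x' y' : V}
    (hxy : Γ.twoWayDist x y = Γ.twoWayDist x' y') :
    {z | P x z ∧ Q z y}.ncard = {z | P x' z ∧ Q z y'}.ncard := by
  obtain ⟨φ, hφ⟩ := h.exists_perm hxy
  rw [← Set.ncard_image_of_injective _ φ.injective]
  congr 1
  ext z
  rw [← φ.apply_symm_apply z]
  simp only [Set.mem_image, Set.mem_ofPred_eq, EmbeddingLike.apply_eq_iff_eq, exists_eq_right]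
  constructor
  · exact fun hz => ⟨hP (hφ _).1.symm hz.1, hQ (hφ _).2.symm hz.2⟩
  · exact fun hz => ⟨hP (hφ _).1 hz.1, hQ (hφ _).2 hz.2⟩

/-- Out-degrees of coherent relations do not depend on the vertex. -/
theorem Coherent.ncard_out [Finite V] (h : Γ.IsWeaklyDistanceRegular) {P : V → V → Prop}
    (hP : Γ.Coherent P) (x x' : V) : {y | P x y}.ncard = {y | P x' y}.ncard := by
  have := hP.ncard_eq h (Q := fun _ _ => True) (fun _ _ _ _ _ _ => trivial)
    ((twoWayDist_self (Γ := Γ) x).trans (twoWayDist_self x').symm)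
  simpa using this

/-- In-degrees of coherent relations equal their out-degrees. -/
theorem Coherent.ncard_in [Finite V] (h : Γ.IsWeaklyDistanceRegular) {P : V → V → Prop}
    (hP : Γ.Coherent P) (x : V) : {y | P y x}.ncard = {y | P x y}.ncard := by
  classical
  have := Fintype.ofFinite V
  have h1 : ∑ u : V, {y | P u y}.ncard = ∑ u : V, {y | P y u}.ncard := by
    simp only [Set.ncard_eq_toFinset_card', Set.toFinset_ofPred, Finset.card_filter]
    exact Finset.sum_comm
  rw [Finset.sum_congr rfl fun u _ => hP.ncard_out h u x,
    Finset.sum_congr rfl fun u _ => hP.swap.ncard_out h u x] at h1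
  simp only [Finset.sum_const, smul_eq_mul] at h1
  exact (Nat.eq_of_mul_eq_mul_left (Finset.card_pos.2 ⟨x, Finset.mem_univ x⟩) h1).symm

end Coherent

/-! ### Weakly distance-regular digraphs with a thin and a forked arc type -/

section Setup

variable {V : Type*}

/-- The arcs of the weakly distance-regular digraph `Γ` are the arcs `(x, σ x)`, of type `(1, p)`,
and the arcs of the relation `B`, of type `(1, q)`, of which two leave and two enter each
vertex. No arc is contained in a circuit of length two. -/
structure IsShiftFork (Γ : Digraph V) (σ : Equiv.Perm V) (B : V → V → Prop) (p q : ℕ) :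
    Prop where
  wdr : Γ.IsWeaklyDistanceRegular
  adj_iff : ∀ x y, Γ.Adj x y ↔ y = σ x ∨ B x y
  shift_iff : ∀ x y, Γ.twoWayDist x y = (1, p) ↔ y = σ x
  fork_iff : ∀ x y, Γ.twoWayDist x y = (1, q) ↔ B x y
  ncard_out : ∀ x, {y | B x y}.ncard = 2
  ncard_in : ∀ y, {x | B x y}.ncard = 2
  asymm : ∀ x y, Γ.Adj x y → ¬ Γ.Adj y x
  ne : p ≠ q

theorem asymm_of_two_lt_girth {Γ : Digraph V} (hsc : Γ.StronglyConnected)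
    (hloop : ∀ x, ¬ Γ.Adj x x) (hg : 2 < Γ.girth) (x y : V) (hxy : Γ.Adj x y) :
    ¬ Γ.Adj y x := by
  intro hyx
  have hne : y ≠ x := fun h => hloop x (h ▸ hxy)
  have hc : Γ.IsCircuit 2 fun t => if t = 0 then x else y := by
    refine ⟨by norm_num, fun t ht => ?_, ?_⟩
    · obtain rfl : t = 0 := by omega
      simpa using hxy
    · simpa using hsc.dist_eq_one hyx hne
  have : Γ.girth ≤ 2 := iInf₂_le (2 : ℕ) ⟨_, hc⟩
  exact absurd hg (not_lt.2 this)

/-- A weakly distance-regular digraph of valency three and girth more than two with two types of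
arcs has one type of arcs of valency one and another of valency two. -/
theorem exists_isShiftFork [Finite V] {Γ : Digraph V} (hloop : ∀ x, ¬ Γ.Adj x x)
    (hwdr : Γ.IsWeaklyDistanceRegular) (hval : Γ.HasValency 3) (hg : 2 < Γ.girth)
    (htypes : Γ.arcTypes.ncard = 2) :
    ∃ (σ : Equiv.Perm V) (B : V → V → Prop) (p q : ℕ), Γ.IsShiftFork σ B p q := by
  have hsc := hwdr.1
  have hadj1 : ∀ {x y}, Γ.Adj x y → Γ.dist x y = 1 := fun {x y} h =>
    hsc.dist_eq_one h fun e => hloop x (by rwa [← e] at h)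
  obtain ⟨a, b, hab, hset⟩ := Set.ncard_eq_two.1 htypes
  have key : ∀ a b : ℕ × ℕ, a ≠ b → Γ.arcTypes = {a, b} →
      (∀ x, {y | Γ.twoWayDist x y = a}.ncard = 1) → (∀ x, {y | Γ.twoWayDist x y = b}.ncard = 2) →
      ∃ (σ : Equiv.Perm V) (B : V → V → Prop) (p q : ℕ), Γ.IsShiftFork σ B p q := by
    intro a b hab hset ha hb
    have hain : a ∈ Γ.arcTypes := hset ▸ Set.mem_insert a _
    have hbin : b ∈ Γ.arcTypes := hset ▸ Set.mem_insert_of_mem a rfl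
    obtain ⟨u, v, huv, hau⟩ := hain
    obtain ⟨u', v', huv', hbu⟩ := hbin
    have hex : ∀ x, ∃ y, ∀ z, Γ.twoWayDist x z = a ↔ z = y := fun x => by
      obtain ⟨y, hy⟩ := Set.ncard_eq_one.1 (ha x)
      exact ⟨y, fun z => by simpa using Set.ext_iff.1 hy z⟩
    choose f hf using hex
    have hinj : Function.Injective f := by
      intro x x' hxx
      have h1 : {y | Γ.twoWayDist y (f x) = a}.ncard = 1 :=
        ((coherent_twoWayDist a).ncard_in hwdr (f x)).trans (ha _)
      obtain ⟨w, hw⟩ := Set.ncard_eq_one.1 h1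
      have e1 : x ∈ ({w} : Set V) := hw ▸ (hf x (f x)).2 rfl
      have e2 : x' ∈ ({w} : Set V) := hw ▸ (hf x' (f x)).2 hxx
      rw [Set.mem_singleton_iff] at e1 e2
      rw [e1, e2]
    refine ⟨Equiv.ofBijective f (Finite.injective_iff_bijective.1 hinj),
      fun x y => Γ.twoWayDist x y = b, a.2, b.2, hwdr, fun x y => ?_, fun x y => ?_, fun x y => ?_,
      hb, fun y => ((coherent_twoWayDist b).ncard_in hwdr y).trans (hb y),
      asymm_of_two_lt_girth hsc hloop hg, fun h => hab ?_⟩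
    · rw [Equiv.ofBijective_apply, ← hf]
      constructor
      · intro h
        have h1 : (1, Γ.dist y x) ∈ Γ.arcTypes := ⟨x, y, h, rfl⟩
        rw [hset] at h1
        simpa [twoWayDist, hadj1 h, Set.mem_insert_iff] using h1
      · rintro (h | h)
        · exact hsc.adj_of_dist_eq_one (by rw [hau] at h; exact congrArg Prod.fst h)
        · exact hsc.adj_of_dist_eq_one (by rw [hbu] at h; exact congrArg Prod.fst h)
    · rw [Equiv.ofBijective_apply, ← hf, hau]
    · rw [hbu]
    · rw [hau, hbu] at h ⊢
      exact congrArg (Prod.mk 1) h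
  have hain : a ∈ Γ.arcTypes := hset ▸ Set.mem_insert a _
  have hbin : b ∈ Γ.arcTypes := hset ▸ Set.mem_insert_of_mem a rfl
  obtain ⟨u, v, huv, hau⟩ := hain
  obtain ⟨u', v', huv', hbu⟩ := hbin
  have hsum : ∀ x, {y | Γ.twoWayDist x y = a}.ncard + {y | Γ.twoWayDist x y = b}.ncard = 3 := by
    intro x
    rw [← hval x, ← Set.ncard_union_eq]
    · congr 1
      ext y
      simp only [Set.mem_union, Set.mem_ofPred_eq]
      constructor
      · rintro (h | h)
        · exact hsc.adj_of_dist_eq_one (by rw [hau] at h; exact congrArg Prod.fst h)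
        · exact hsc.adj_of_dist_eq_one (by rw [hbu] at h; exact congrArg Prod.fst h)
      · intro h
        have h1 : (1, Γ.dist y x) ∈ Γ.arcTypes := ⟨x, y, h, rfl⟩
        rw [hset] at h1
        simpa [twoWayDist, hadj1 h, Set.mem_insert_iff] using h1
    · rw [Set.disjoint_left]
      intro y h1 h2
      exact hab (h1.symm.trans h2)
  have ha : ∀ x, 0 < {y | Γ.twoWayDist x y = a}.ncard := fun x => by
    rw [(coherent_twoWayDist a).ncard_out hwdr x u, Set.ncard_pos]
    exact ⟨v, by simp [twoWayDist, hadj1 huv, hau]⟩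
  have hb : ∀ x, 0 < {y | Γ.twoWayDist x y = b}.ncard := fun x => by
    rw [(coherent_twoWayDist b).ncard_out hwdr x u', Set.ncard_pos]
    exact ⟨v', by simp [twoWayDist, hadj1 huv', hbu]⟩
  by_cases h1 : {y | Γ.twoWayDist u y = a}.ncard = 1
  · refine key a b hab hset (fun x => ?_) fun x => ?_
    · exact ((coherent_twoWayDist a).ncard_out hwdr x u).trans h1
    · have := hsum x
      have := (coherent_twoWayDist a).ncard_out hwdr x u
      omega
  · refine key b a hab.symm (hset.trans (Set.pair_comm a b)) (fun x => ?_) fun x => ?_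
    all_goals
      have := hsum x
      have := ha x
      have := hb x
      have := (coherent_twoWayDist a).ncard_out hwdr x u
      omega

end Setup

end Digraph

namespace Digraph

/-! ### The thin relation commutes with the forked relation -/

section Basic

variable {V : Type*} {Γ : Digraph V}

/-- A coherent relation that holds on the diagonal once always does. -/
theorem Coherent.diag {P : V → V → Prop} (hP : Γ.Coherent P) {x : V} (hx : P x x) (y : V) :
    P y y :=
  hP ((twoWayDist_self x).trans (twoWayDist_self y).symm) hx

/-- A coherent relation that holds somewhere has out-neighbours everywhere. -/
theorem Coherent.exists_right [Finite V] (h : Γ.IsWeaklyDistanceRegular) {P : V → V → Prop}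
    (hP : Γ.Coherent P) {x y : V} (hxy : P x y) (x' : V) : ∃ y', P x' y' := by
  obtain ⟨z, hz, -⟩ := hP.comp h (Q := fun _ _ => True) (fun _ _ _ _ _ _ => trivial)
    ((twoWayDist_self (Γ := Γ) x).trans (twoWayDist_self x').symm) ⟨y, hxy, trivial⟩
  exact ⟨z, hz⟩

end Basic

namespace IsShiftFork

variable {V : Type*} {Γ : Digraph V} {σ : Equiv.Perm V} {B : V → V → Prop} {p q : ℕ}

theorem stronglyConnected (h : Γ.IsShiftFork σ B p q) : Γ.StronglyConnected := h.wdr.1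

theorem coherent_fork (h : Γ.IsShiftFork σ B p q) : Γ.Coherent B := fun x y x' y' hxy hB =>
  (h.fork_iff x' y').1 (hxy.symm.trans ((h.fork_iff x y).2 hB))

theorem twoWayDist_fork (h : Γ.IsShiftFork σ B p q) {x y x' y' : V} (hxy : B x y)
    (hxy' : B x' y') : Γ.twoWayDist x y = Γ.twoWayDist x' y' :=
  ((h.fork_iff x y).2 hxy).trans ((h.fork_iff x' y').2 hxy').symm

theorem shift_adj (h : Γ.IsShiftFork σ B p q) (x : V) : Γ.Adj x (σ x) :=
  (h.adj_iff _ _).2 (Or.inl rfl)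

theorem fork_adj (h : Γ.IsShiftFork σ B p q) {x y : V} (hxy : B x y) : Γ.Adj x y :=
  (h.adj_iff _ _).2 (Or.inr hxy)

theorem ne_of_adj (h : Γ.IsShiftFork σ B p q) {x y : V} (hxy : Γ.Adj x y) : x ≠ y := by
  rintro rfl
  exact h.asymm x x hxy hxy

theorem shift_ne (h : Γ.IsShiftFork σ B p q) (x : V) : σ x ≠ x := (h.ne_of_adj (h.shift_adj x)).symm

theorem shift_shift_ne (h : Γ.IsShiftFork σ B p q) (x : V) : σ (σ x) ≠ x := fun e =>
  h.asymm x (σ x) (h.shift_adj x) (by simpa [e] using h.shift_adj (σ x))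

theorem dist_shift (h : Γ.IsShiftFork σ B p q) (x : V) : Γ.dist (σ x) x = p :=
  congrArg Prod.snd ((h.shift_iff x (σ x)).2 rfl)

theorem dist_fork (h : Γ.IsShiftFork σ B p q) {x y : V} (hxy : B x y) : Γ.dist y x = q :=
  congrArg Prod.snd ((h.fork_iff x y).2 hxy)

theorem exists_fork (h : Γ.IsShiftFork σ B p q) (x : V) : ∃ y, B x y := by
  have : {y | B x y}.Nonempty := by
    exact Set.nonempty_of_ncard_ne_zero (by simp [h.ncard_out x])
  exact this

theorem exists_other_out (h : Γ.IsShiftFork σ B p q) {x y : V} (hxy : B x y) :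
    ∃ y', y' ≠ y ∧ B x y' ∧ ∀ z, B x z → z = y ∨ z = y' := by
  obtain ⟨a, b, hab, hset⟩ := Set.ncard_eq_two.1 (h.ncard_out x)
  have hmem : ∀ z, B x z ↔ z = a ∨ z = b := fun z => by simpa using Set.ext_iff.1 hset z
  rcases (hmem y).1 hxy with rfl | rfl
  · exact ⟨b, hab.symm, (hmem b).2 (Or.inr rfl), fun z hz => (hmem z).1 hz⟩
  · exact ⟨a, hab, (hmem a).2 (Or.inl rfl), fun z hz => ((hmem z).1 hz).symm⟩

theorem exists_other_in (h : Γ.IsShiftFork σ B p q) {x y : V} (hxy : B x y) :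
    ∃ x', x' ≠ x ∧ B x' y ∧ ∀ z, B z y → z = x ∨ z = x' := by
  obtain ⟨a, b, hab, hset⟩ := Set.ncard_eq_two.1 (h.ncard_in y)
  have hmem : ∀ z, B z y ↔ z = a ∨ z = b := fun z => by simpa using Set.ext_iff.1 hset z
  rcases (hmem x).1 hxy with rfl | rfl
  · exact ⟨b, hab.symm, (hmem b).2 (Or.inr rfl), fun z hz => (hmem z).1 hz⟩
  · exact ⟨a, hab, (hmem a).2 (Or.inl rfl), fun z hz => ((hmem z).1 hz).symm⟩

theorem eq_or_eq_of_out (h : Γ.IsShiftFork σ B p q) {x a b c : V} (ha : B x a) (hb : B x b)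
    (hab : a ≠ b) (hc : B x c) : c = a ∨ c = b := by
  obtain ⟨d, -, -, hall⟩ := h.exists_other_out ha
  rcases hall b hb with rfl | rfl
  · exact absurd rfl hab
  · exact hall c hc

theorem eq_or_eq_of_in (h : Γ.IsShiftFork σ B p q) {x a b c : V} (ha : B a x) (hb : B b x)
    (hab : a ≠ b) (hc : B c x) : c = a ∨ c = b := by
  obtain ⟨d, -, -, hall⟩ := h.exists_other_in ha
  rcases hall b hb with rfl | rfl
  · exact absurd rfl hab
  · exact hall c hc

theorem two_le_shift (h : Γ.IsShiftFork σ B p q) [Nonempty V] : 2 ≤ p := by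
  obtain ⟨x⟩ := ‹Nonempty V›
  have h0 : p ≠ 0 := fun e =>
    h.shift_ne x (h.stronglyConnected.eq_of_dist_eq_zero ((h.dist_shift x).trans e))
  have h1 : p ≠ 1 := fun e => h.asymm _ _ (h.shift_adj x)
    (h.stronglyConnected.adj_of_dist_eq_one ((h.dist_shift x).trans e))
  omega

theorem two_le_fork (h : Γ.IsShiftFork σ B p q) [Nonempty V] : 2 ≤ q := by
  obtain ⟨x⟩ := ‹Nonempty V›
  obtain ⟨y, hy⟩ := h.exists_fork x
  have h0 : q ≠ 0 := fun e => (h.ne_of_adj (h.fork_adj hy)).symm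
    (h.stronglyConnected.eq_of_dist_eq_zero ((h.dist_fork hy).trans e))
  have h1 : q ≠ 1 := fun e => h.asymm _ _ (h.fork_adj hy)
    (h.stronglyConnected.adj_of_dist_eq_one ((h.dist_fork hy).trans e))
  omega

theorem dist_shift_fork (h : Γ.IsShiftFork σ B p q) {x y : V} (hxy : B (σ x) y)
    (hne : ¬ B x y) : Γ.dist x y = 2 := by
  have hle : Γ.dist x y ≤ 2 := ((h.shift_adj x).hasPath.trans (h.fork_adj hxy).hasPath).dist_le
  have h0 : Γ.dist x y ≠ 0 := fun e => by
    have := h.stronglyConnected.eq_of_dist_eq_zero e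
    subst this
    exact h.asymm _ _ (h.fork_adj hxy) (h.shift_adj x)
  have h1 : Γ.dist x y ≠ 1 := fun e => by
    rcases (h.adj_iff x y).1 (h.stronglyConnected.adj_of_dist_eq_one e) with rfl | e
    · exact h.ne_of_adj (h.fork_adj hxy) rfl
    · exact hne e
  omega

theorem dist_fork_shift (h : Γ.IsShiftFork σ B p q) {x y : V} (hxy : B x y)
    (hne : ¬ B x (σ y)) : Γ.dist x (σ y) = 2 := by
  have hle : Γ.dist x (σ y) ≤ 2 := ((h.fork_adj hxy).hasPath.trans (h.shift_adj y).hasPath).dist_le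
  have h0 : Γ.dist x (σ y) ≠ 0 := fun e => by
    have := h.stronglyConnected.eq_of_dist_eq_zero e
    rw [this] at hxy
    exact h.asymm _ _ (h.fork_adj hxy) (h.shift_adj y)
  have h1 : Γ.dist x (σ y) ≠ 1 := fun e => by
    rcases (h.adj_iff x (σ y)).1 (h.stronglyConnected.adj_of_dist_eq_one e) with e | e
    · exact h.ne_of_adj (h.fork_adj hxy) (σ.injective e).symm
    · exact hne e
  omega

/-- A closed walk passing an arc of `B` and then returning to an arc of `σ` contains an arc of `B`
directly followed by an arc of `σ`. -/
theorem exists_fork_shift (h : Γ.IsShiftFork σ B p q) {i k : ℕ} {u v x : V} (huv : B u v)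
    (hp : Γ.HasPath i v x) (hk : Γ.HasPath k (σ x) u) :
    ∃ a b, B a b ∧ Γ.HasPath (i + k) (σ b) a := by
  induction i generalizing u v k with
  | zero =>
    rw [hasPath_zero] at hp; subst hp
    exact ⟨u, v, huv, by simpa using hk⟩
  | succ i ih =>
    obtain ⟨w, hw, hwx⟩ := hasPath_succ.1 hp
    rcases (h.adj_iff v w).1 hw with rfl | hvw
    · refine ⟨u, v, huv, ?_⟩
      have := (hwx.trans (h.shift_adj x).hasPath).trans hk
      exact this
    · obtain ⟨a, b, hab, hpath⟩ := ih hvw hwx (hk.trans (h.fork_adj huv).hasPath)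
      exact ⟨a, b, hab, by convert hpath using 1; omega⟩

/-- A closed walk passing an arc of `σ` and then returning to an arc of `B` contains an arc of `σ`
directly followed by an arc of `B`. -/
theorem exists_shift_fork (h : Γ.IsShiftFork σ B p q) {i k : ℕ} {u v x : V} (hxv : B x v)
    (hp : Γ.HasPath i (σ u) x) (hk : Γ.HasPath k v u) :
    ∃ a b, B (σ a) b ∧ Γ.HasPath (i + k) b a := by
  induction i generalizing u k with
  | zero =>
    rw [hasPath_zero] at hp; subst hp
    exact ⟨u, v, hxv, by simpa using hk⟩
  | succ i ih =>
    obtain ⟨w, hw, hwx⟩ := hasPath_succ.1 hp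
    rcases (h.adj_iff (σ u) w).1 hw with rfl | huw
    · obtain ⟨a, b, hab, hpath⟩ := ih hwx (hk.trans (h.shift_adj u).hasPath)
      exact ⟨a, b, hab, by convert hpath using 1; omega⟩
    · exact ⟨u, w, huw, (hwx.trans (h.fork_adj hxv).hasPath).trans hk⟩

variable [Finite V]

theorem coherent_zpow (h : Γ.IsShiftFork σ B p q) (k : ℤ) :
    Γ.Coherent fun x y => y = (σ ^ k) x := by
  have h1 : Γ.Coherent fun x y => y = σ x := fun x y x' y' hxy e =>
    (h.shift_iff x' y').1 (hxy.symm.trans ((h.shift_iff x y).2 e))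
  have hn : ∀ n : ℕ, Γ.Coherent fun x y => y = (σ ^ n) x := by
    intro n
    induction n with
    | zero =>
      intro x y x' y' hxy e
      simp only [pow_zero, Equiv.Perm.coe_one, id_eq] at e ⊢
      subst e
      exact (h.stronglyConnected.eq_of_twoWayDist hxy.symm).symm
    | succ n ih =>
      intro x y x' y' hxy e
      obtain ⟨z, hz, e'⟩ := h1.comp h.wdr ih hxy ⟨σ x, rfl, by rw [e, pow_succ]; rfl⟩
      rw [e', hz, pow_succ]; rfl
  obtain ⟨n, rfl | rfl⟩ := k.eq_nat_or_neg
  · simpa using hn n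
  · have := (hn n).swap
    intro x y x' y' hxy e
    rw [zpow_neg, zpow_natCast, Equiv.Perm.eq_inv_iff_eq] at e ⊢
    exact (this hxy e.symm).symm

theorem coherent_shift_left (h : Γ.IsShiftFork σ B p q) {P : V → V → Prop} (hP : Γ.Coherent P)
    (k : ℤ) : Γ.Coherent fun x y => P ((σ ^ k) x) y := by
  have := (h.coherent_zpow k).comp h.wdr hP
  simpa using this

theorem coherent_shift_right (h : Γ.IsShiftFork σ B p q) {P : V → V → Prop} (hP : Γ.Coherent P)
    (k : ℤ) : Γ.Coherent fun x y => P x ((σ ^ k) y) :=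
  (h.coherent_shift_left hP.swap k).swap

theorem twoWayDist_shift_left (h : Γ.IsShiftFork σ B p q) {x y x' y' : V} (k : ℤ)
    (hxy : Γ.twoWayDist x y = Γ.twoWayDist x' y') :
    Γ.twoWayDist ((σ ^ k) x) y = Γ.twoWayDist ((σ ^ k) x') y' :=
  ((h.coherent_shift_left (coherent_twoWayDist _) k) hxy rfl).symm

theorem twoWayDist_shift_right (h : Γ.IsShiftFork σ B p q) {x y x' y' : V} (k : ℤ)
    (hxy : Γ.twoWayDist x y = Γ.twoWayDist x' y') :
    Γ.twoWayDist x ((σ ^ k) y) = Γ.twoWayDist x' ((σ ^ k) y') :=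
  twoWayDist_swap (h.twoWayDist_shift_left k (twoWayDist_swap hxy))

theorem eq_zpow_of_twoWayDist (h : Γ.IsShiftFork σ B p q) {x y x' : V} {k : ℤ}
    (hxy : Γ.twoWayDist x y = Γ.twoWayDist x' ((σ ^ k) x')) : y = (σ ^ k) x :=
  h.coherent_zpow k hxy.symm rfl

theorem twoWayDist_zpow (h : Γ.IsShiftFork σ B p q) (x y : V) (k : ℤ) :
    Γ.twoWayDist x ((σ ^ k) x) = Γ.twoWayDist y ((σ ^ k) y) := by
  obtain ⟨z, hz⟩ := (coherent_twoWayDist (Γ.twoWayDist x ((σ ^ k) x))).exists_right h.wdr rfl y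
  rw [← h.eq_zpow_of_twoWayDist hz, hz]

/-- The thin relation generates a semiregular group. -/
theorem zpow_eq_one (h : Γ.IsShiftFork σ B p q) {k : ℤ} {x : V} (hx : (σ ^ k) x = x) :
    σ ^ k = 1 :=
  Equiv.ext fun y => ((h.coherent_zpow k).diag hx.symm y).symm

theorem not_fork_zpow (h : Γ.IsShiftFork σ B p q) (x : V) (k : ℤ) : ¬ B x ((σ ^ k) x) := by
  intro hx
  obtain ⟨y, hne, hy, -⟩ := h.exists_other_out hx
  exact hne (h.eq_zpow_of_twoWayDist (h.twoWayDist_fork hy hx))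

theorem not_fork_shift (h : Γ.IsShiftFork σ B p q) (x : V) : ¬ B x (σ x) := by
  simpa using h.not_fork_zpow x 1

theorem not_fork_of_zpow (h : Γ.IsShiftFork σ B p q) (x : V) (k : ℤ) : ¬ B ((σ ^ k) x) x := by
  have := h.not_fork_zpow ((σ ^ k) x) (-k)
  simpa [← Equiv.Perm.mul_apply] using this

theorem fork_shift_left_disjoint (h : Γ.IsShiftFork σ B p q) {x y : V} (hxy : B x y) :
    ¬ B (σ x) y := by
  intro hy
  have hall : ∀ u v, B u v → B (σ u) v := fun u v huv => by
    have := h.coherent_shift_left h.coherent_fork 1 (h.twoWayDist_fork hxy huv) (by simpa using hy)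
    simpa using this
  rcases h.eq_or_eq_of_in hxy hy (h.shift_ne x).symm (hall _ _ hy) with e | e
  · exact h.shift_shift_ne x e
  · exact h.shift_ne _ e

theorem fork_shift_right_disjoint (h : Γ.IsShiftFork σ B p q) {x y : V} (hxy : B x y) :
    ¬ B x (σ y) := by
  intro hy
  have hall : ∀ u v, B u v → B u (σ v) := fun u v huv => by
    have := h.coherent_shift_right h.coherent_fork 1 (h.twoWayDist_fork hxy huv) (by simpa using hy)
    simpa using this
  rcases h.eq_or_eq_of_out hxy hy (h.shift_ne y).symm (hall _ _ hy) with e | e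
  · exact h.shift_shift_ne y e
  · exact h.shift_ne _ e

theorem twoWayDist_shift_fork (h : Γ.IsShiftFork σ B p q) {x y x' y' : V} (hxy : B (σ x) y)
    (hxy' : B (σ x') y') : Γ.twoWayDist x y = Γ.twoWayDist x' y' := by
  have := h.twoWayDist_shift_left (-1) (h.twoWayDist_fork hxy hxy')
  simpa using this

/-- The two arc relations commute: their two products have the same two-way distance, since a
closed walk that uses both types of arcs changes from either type to the other. -/
theorem fork_shift (h : Γ.IsShiftFork σ B p q) {x w : V} (hxw : B x w) : B (σ x) (σ w) := by
  obtain ⟨y, hy⟩ := h.exists_fork (σ x)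
  have hBA : ∀ {a b : V}, B a b → Γ.twoWayDist a (σ b) = Γ.twoWayDist x (σ w) := fun {a b} hab => by
    have := h.twoWayDist_shift_right 1 (h.twoWayDist_fork hab hxw)
    simpa using this
  have h1 : Γ.dist (σ w) x ≤ Γ.dist y x := by
    obtain ⟨a, b, hab, hpath⟩ := h.exists_fork_shift (k := 0) hy
      (h.stronglyConnected.hasPath_dist y x) (hasPath_zero.2 rfl)
    have := hpath.dist_le
    rwa [show Γ.dist (σ b) a = Γ.dist (σ w) x from congrArg Prod.snd (hBA hab)] at this
  have h2 : Γ.dist y x ≤ Γ.dist (σ w) x := by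
    obtain ⟨a, b, hab, hpath⟩ := h.exists_shift_fork (k := 0) hxw
      (h.stronglyConnected.hasPath_dist (σ w) x) (hasPath_zero.2 rfl)
    have := hpath.dist_le
    rwa [show Γ.dist b a = Γ.dist y x from
      congrArg Prod.snd (h.twoWayDist_shift_fork hab hy)] at this
  have h3 : Γ.twoWayDist x y = Γ.twoWayDist x (σ w) := by
    simp only [twoWayDist, Prod.mk.injEq]
    exact ⟨(h.dist_shift_fork hy fun e => h.fork_shift_left_disjoint e hy).trans
      (h.dist_fork_shift hxw (h.fork_shift_right_disjoint hxw)).symm, le_antisymm h2 h1⟩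
  simpa using h.coherent_shift_left h.coherent_fork 1 h3 (by simpa using hy)

theorem fork_zpow_iff (h : Γ.IsShiftFork σ B p q) (k : ℤ) {x y : V} :
    B ((σ ^ k) x) ((σ ^ k) y) ↔ B x y := by
  have hn : ∀ (n : ℕ) {x y : V}, B x y → B ((σ ^ n) x) ((σ ^ n) y) := by
    intro n
    induction n with
    | zero => exact id
    | succ n ih =>
      intro x y hxy
      have := h.fork_shift (ih hxy)
      rwa [← Equiv.Perm.mul_apply, ← Equiv.Perm.mul_apply, ← pow_succ'] at this
  have hz : ∀ (k : ℤ) {x y : V}, B x y → B ((σ ^ k) x) ((σ ^ k) y) := by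
    intro k x y hxy
    obtain ⟨m, hm0, hm⟩ := isOfFinOrder_iff_pow_eq_one.1 (isOfFinOrder_of_finite σ)
    have : σ ^ k = σ ^ (k % m).toNat := by
      rw [← zpow_natCast, Int.toNat_of_nonneg (Int.emod_nonneg _ (by omega))]
      conv_lhs => rw [← Int.emod_add_mul_ediv k m, zpow_add, zpow_mul]
      simp [hm]
    rw [this]
    exact hn _ hxy
  refine ⟨fun hB => ?_, hz k⟩
  have := hz (-k) hB
  simpa [← Equiv.Perm.mul_apply] using this

theorem fork_pow_iff (h : Γ.IsShiftFork σ B p q) (n : ℕ) {x y : V} :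
    B ((σ ^ n) x) ((σ ^ n) y) ↔ B x y := by
  simpa using h.fork_zpow_iff n (x := x) (y := y)

theorem fork_shift_iff (h : Γ.IsShiftFork σ B p q) {x y : V} : B (σ x) (σ y) ↔ B x y := by
  simpa using h.fork_zpow_iff 1 (x := x) (y := y)

end IsShiftFork

end Digraph

namespace Digraph

/-! ### Shapes of closed walks -/

section Walks

variable {V : Type*}

/-- `StepWalk B j x y` says that `y` is reached from `x` by `j` steps along the relation `B`. -/
def StepWalk (B : V → V → Prop) : ℕ → V → V → Prop
  | 0, x, y => x = y
  | j + 1, x, y => ∃ z, B x z ∧ StepWalk B j z y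

/-- There is a closed walk consisting of `i` steps of `σ` and `j` steps of `B` at every vertex. -/
def ClosedShape (σ : Equiv.Perm V) (B : V → V → Prop) (i j : ℕ) : Prop :=
  ∀ x, StepWalk B j ((σ ^ i) x) x

/-- `M` is the least length of a closed walk that uses both `σ` and `B`. -/
def IsMixedLength (σ : Equiv.Perm V) (B : V → V → Prop) (M : ℕ) : Prop :=
  IsLeast {L | ∃ i j, 1 ≤ i ∧ 1 ≤ j ∧ i + j = L ∧ ClosedShape σ B i j} M

/-- `L` is the least length of a nontrivial closed walk that uses `B` only. -/
def IsPureLength (σ : Equiv.Perm V) (B : V → V → Prop) (L : ℕ) : Prop :=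
  IsLeast {L | 1 ≤ L ∧ ClosedShape σ B 0 L} L

variable {B : V → V → Prop}

theorem StepWalk.trans {a b : ℕ} {x y z : V} (h₁ : StepWalk B a x y) (h₂ : StepWalk B b y z) :
    StepWalk B (a + b) x z := by
  induction a generalizing x with
  | zero => obtain rfl : x = y := h₁; simpa using h₂
  | succ a ih =>
    obtain ⟨u, hu, h⟩ := h₁
    rw [Nat.add_right_comm]
    exact ⟨u, hu, ih h⟩

theorem StepWalk.single {x y : V} (h : B x y) : StepWalk B 1 x y := ⟨y, h, rfl⟩

theorem StepWalk.exists_split {a b : ℕ} {x z : V} (h : StepWalk B (a + b) x z) :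
    ∃ y, StepWalk B a x y ∧ StepWalk B b y z := by
  induction a generalizing x with
  | zero => exact ⟨x, rfl, by simpa using h⟩
  | succ a ih =>
    rw [Nat.add_right_comm] at h
    obtain ⟨u, hu, h⟩ := h
    obtain ⟨y, hy, hz⟩ := ih h
    exact ⟨y, ⟨u, hu, hy⟩, hz⟩

theorem StepWalk.exists_last {a : ℕ} {x z : V} (h : StepWalk B (a + 1) x z) :
    ∃ y, StepWalk B a x y ∧ B y z := by
  obtain ⟨y, hy, u, hu, rfl⟩ := h.exists_split
  exact ⟨y, hy, hu⟩

theorem exists_isPureLength {σ : Equiv.Perm V} {L : ℕ} (hL : 1 ≤ L)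
    (hc : ClosedShape σ B 0 L) : ∃ l ≤ L, IsPureLength σ B l := by
  classical
  have hne : ∃ L, L ∈ {L | 1 ≤ L ∧ ClosedShape σ B 0 L} := ⟨L, hL, hc⟩
  exact ⟨Nat.find hne, Nat.find_min' hne ⟨hL, hc⟩, Nat.find_spec hne,
    fun L hL => Nat.find_min' hne hL⟩

theorem IsMixedLength.le {σ : Equiv.Perm V} {M i j : ℕ} (hM : IsMixedLength σ B M) (hi : 1 ≤ i)
    (hj : 1 ≤ j) (hc : ClosedShape σ B i j) : M ≤ i + j :=
  hM.2 ⟨i, j, hi, hj, rfl, hc⟩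

theorem IsPureLength.le {σ : Equiv.Perm V} {l L : ℕ} (hl : IsPureLength σ B l) (hL : 1 ≤ L)
    (hc : ClosedShape σ B 0 L) : l ≤ L :=
  hl.2 ⟨hL, hc⟩

end Walks

namespace IsShiftFork

variable {V : Type*} {Γ : Digraph V} {σ : Equiv.Perm V} {B : V → V → Prop} {p q : ℕ}

theorem hasPath_pow (h : Γ.IsShiftFork σ B p q) (n : ℕ) (x : V) : Γ.HasPath n x ((σ ^ n) x) := by
  induction n with
  | zero => exact hasPath_zero.2 rfl
  | succ n ih =>
    rw [pow_succ']
    exact ih.trans (h.shift_adj _).hasPath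

theorem hasPath_of_stepWalk (h : Γ.IsShiftFork σ B p q) {j : ℕ} {x y : V}
    (hw : StepWalk B j x y) : Γ.HasPath j x y := by
  induction j generalizing x with
  | zero => exact hasPath_zero.2 hw
  | succ j ih =>
    obtain ⟨z, hz, hw⟩ := hw
    exact hasPath_succ.2 ⟨z, h.fork_adj hz, ih hw⟩

theorem fork_le (h : Γ.IsShiftFork σ B p q) [Nonempty V] {i j : ℕ} (hj : 1 ≤ j)
    (hc : ClosedShape σ B i j) : q + 1 ≤ i + j := by
  obtain ⟨x⟩ := ‹Nonempty V›
  obtain ⟨j, rfl⟩ := Nat.exists_eq_add_of_le' hj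
  obtain ⟨u, hu, hw⟩ := hc x
  have := ((h.hasPath_of_stepWalk hw).trans (h.hasPath_pow i x)).dist_le
  rw [h.dist_fork hu] at this
  omega

theorem three_le_pure (h : Γ.IsShiftFork σ B p q) [Nonempty V] {l : ℕ}
    (hl : IsPureLength σ B l) : 3 ≤ l := by
  have h1 := h.fork_le hl.1.1 hl.1.2
  have h2 := h.two_le_fork
  omega

variable [Finite V]

theorem coherent_stepWalk (h : Γ.IsShiftFork σ B p q) (j : ℕ) : Γ.Coherent (StepWalk B j) := by
  induction j with
  | zero => simpa [StepWalk, eq_comm] using h.coherent_zpow 0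
  | succ j ih => exact h.coherent_fork.comp h.wdr ih

theorem stepWalk_pow_iff (h : Γ.IsShiftFork σ B p q) (n : ℕ) {j : ℕ} {x y : V} :
    StepWalk B j ((σ ^ n) x) ((σ ^ n) y) ↔ StepWalk B j x y := by
  induction j generalizing x with
  | zero => simp [StepWalk]
  | succ j ih =>
    constructor
    · rintro ⟨z, hz, hw⟩
      obtain ⟨z, rfl⟩ := (σ ^ n).surjective z
      exact ⟨z, (h.fork_pow_iff n).1 hz, ih.1 hw⟩
    · rintro ⟨z, hz, hw⟩
      exact ⟨_, (h.fork_pow_iff n).2 hz, ih.2 hw⟩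

/-- As the two arc relations commute, the steps of `σ` in a path may be made first. -/
theorem hasPath_iff (h : Γ.IsShiftFork σ B p q) {r : ℕ} {x y : V} :
    Γ.HasPath r x y ↔ ∃ i j, i + j = r ∧ StepWalk B j ((σ ^ i) x) y := by
  constructor
  · intro hp
    induction r generalizing x with
    | zero => exact ⟨0, 0, rfl, hasPath_zero.1 hp⟩
    | succ r ih =>
      obtain ⟨z, hz, hp⟩ := hasPath_succ.1 hp
      obtain ⟨i, j, rfl, hw⟩ := ih hp
      rcases (h.adj_iff x z).1 hz with rfl | hxz
      · exact ⟨i + 1, j, by omega, by rw [pow_succ]; exact hw⟩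
      · exact ⟨i, j + 1, by omega, _, (h.fork_pow_iff i).2 hxz, hw⟩
  · rintro ⟨i, j, rfl, hw⟩
    exact (h.hasPath_pow i x).trans (h.hasPath_of_stepWalk hw)

theorem dist_le_of_stepWalk (h : Γ.IsShiftFork σ B p q) {i j : ℕ} {x y : V}
    (hw : StepWalk B j ((σ ^ i) x) y) : Γ.dist x y ≤ i + j :=
  (h.hasPath_iff.2 ⟨i, j, rfl, hw⟩).dist_le

theorem exists_stepWalk (h : Γ.IsShiftFork σ B p q) (x y : V) :
    ∃ i j, i + j = Γ.dist x y ∧ StepWalk B j ((σ ^ i) x) y :=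
  h.hasPath_iff.1 (h.stronglyConnected.hasPath_dist x y)

theorem closedShape_of_stepWalk (h : Γ.IsShiftFork σ B p q) {i j : ℕ} {x : V}
    (hw : StepWalk B j ((σ ^ i) x) x) : ClosedShape σ B i j :=
  (h.coherent_shift_left (h.coherent_stepWalk j) i).diag (by simpa using hw)

/-- A pair of vertices joined by a walk, closed by a shortest path. -/
theorem exists_closedShape (h : Γ.IsShiftFork σ B p q) {a b : ℕ} {x z : V}
    (hw : StepWalk B b ((σ ^ a) x) z) :
    ∃ i j, i + j = Γ.dist z x ∧ StepWalk B j ((σ ^ i) z) x ∧ ClosedShape σ B (a + i) (b + j) := by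
  obtain ⟨i, j, hij, hw'⟩ := h.exists_stepWalk z x
  refine ⟨i, j, hij, hw', h.closedShape_of_stepWalk (x := x) ?_⟩
  refine StepWalk.trans ?_ hw'
  rw [add_comm, pow_add]
  exact (h.stepWalk_pow_iff i).2 hw

theorem shift_le (h : Γ.IsShiftFork σ B p q) [Nonempty V] {i j : ℕ} (hi : 1 ≤ i)
    (hc : ClosedShape σ B i j) : p + 1 ≤ i + j := by
  obtain ⟨x⟩ := ‹Nonempty V›
  obtain ⟨i, rfl⟩ := Nat.exists_eq_add_of_le' hi
  have hw := hc x
  rw [pow_succ] at hw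
  have := h.dist_le_of_stepWalk hw
  rw [h.dist_shift] at this
  omega

theorem exists_closedShape_shift (h : Γ.IsShiftFork σ B p q) [Nonempty V] :
    ∃ i j, i + j = p ∧ ClosedShape σ B (1 + i) j := by
  obtain ⟨x⟩ := ‹Nonempty V›
  obtain ⟨i, j, hij, -, hc⟩ := h.exists_closedShape (a := 1) (b := 0) (x := x) rfl
  exact ⟨i, j, hij.trans (h.dist_shift x), by simpa using hc⟩

theorem exists_closedShape_fork (h : Γ.IsShiftFork σ B p q) [Nonempty V] :
    ∃ i j, i + j = q ∧ ClosedShape σ B i (1 + j) := by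
  obtain ⟨x⟩ := ‹Nonempty V›
  obtain ⟨y, hy⟩ := h.exists_fork x
  obtain ⟨i, j, hij, -, hc⟩ := h.exists_closedShape (a := 0) (StepWalk.single hy)
  exact ⟨i, j, hij.trans (h.dist_fork hy), by simpa using hc⟩

theorem not_closedShape_one (h : Γ.IsShiftFork σ B p q) [Nonempty V] (i : ℕ) :
    ¬ ClosedShape σ B i 1 := by
  intro hc
  obtain ⟨x⟩ := ‹Nonempty V›
  obtain ⟨z, hz, rfl⟩ := hc x
  exact h.not_fork_of_zpow z i (by simpa using hz)

theorem exists_isMixedLength (h : Γ.IsShiftFork σ B p q) [Nonempty V] :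
    ∃ M, IsMixedLength σ B M := by
  classical
  obtain ⟨x⟩ := ‹Nonempty V›
  obtain ⟨y, hy⟩ := h.exists_fork (σ x)
  obtain ⟨i, j, -, -, hc⟩ := h.exists_closedShape (a := 1) (b := 1) (x := x)
    (by simpa using StepWalk.single hy)
  have hne : ∃ L, L ∈ {L | ∃ i j, 1 ≤ i ∧ 1 ≤ j ∧ i + j = L ∧ ClosedShape σ B i j} :=
    ⟨_, 1 + i, 1 + j, by omega, by omega, rfl, hc⟩
  exact ⟨Nat.find hne, Nat.find_spec hne, fun L hL => Nat.find_min' hne hL⟩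

theorem four_le_mixed (h : Γ.IsShiftFork σ B p q) [Nonempty V] {M : ℕ}
    (hM : IsMixedLength σ B M) : 4 ≤ M := by
  obtain ⟨i, j, hi, hj, rfl, hc⟩ := hM.1
  have h1 := h.shift_le hi hc
  have h2 := h.fork_le hj hc
  have h3 := h.two_le_shift
  have h4 := h.two_le_fork
  have h5 := h.ne
  omega

/-- A path from `y` back to `x`, where `(x, y)` is in the product of the two arc relations, closes
to a shortest closed walk using both. -/
theorem dist_back (h : Γ.IsShiftFork σ B p q) {M : ℕ} (hM : IsMixedLength σ B M) {x y : V}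
    (hxy : B (σ x) y) : Γ.dist y x + 2 = M := by
  apply le_antisymm
  · obtain ⟨i, j, hi, hj, hij, hc⟩ := hM.1
    obtain ⟨i, rfl⟩ := Nat.exists_eq_add_of_le' hi
    obtain ⟨j, rfl⟩ := Nat.exists_eq_add_of_le' hj
    obtain ⟨u, hu, hw⟩ := hc x
    have hu' : B (σ ((σ ^ i) x)) u := by
      rw [pow_succ'] at hu; exact hu
    have h1 := ((h.hasPath_of_stepWalk hw).trans (h.hasPath_pow i x)).dist_le
    rw [show Γ.dist u ((σ ^ i) x) = Γ.dist y x from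
      congrArg Prod.snd (h.twoWayDist_shift_fork hu' hxy)] at h1
    omega
  · obtain ⟨i, j, hij, -, hc⟩ := h.exists_closedShape (a := 1) (x := x)
      (by simpa using StepWalk.single hxy)
    have := hM.le (by omega) (by omega) hc
    omega

theorem dist_eq_two_of_shift_fork (h : Γ.IsShiftFork σ B p q) {x y : V} (hxy : B (σ x) y) :
    Γ.dist x y = 2 :=
  h.dist_shift_fork hxy fun e => h.fork_shift_left_disjoint e hxy

/-- A pair at the distances of the product of the two arc relations belongs to it. -/
theorem fork_of_dist (h : Γ.IsShiftFork σ B p q) {M : ℕ} (hM : IsMixedLength σ B M) {x z : V}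
    (h1 : Γ.dist x z = 2) (h2 : Γ.dist z x + 2 = M) : B (σ x) z := by
  obtain ⟨y, hy⟩ := h.exists_fork (σ x)
  have h3 : Γ.twoWayDist x y = Γ.twoWayDist x z := by
    have := h.dist_back hM hy
    have := h.dist_eq_two_of_shift_fork hy
    simp only [twoWayDist, Prod.mk.injEq]
    omega
  simpa using h.coherent_shift_left h.coherent_fork 1 h3 (by simpa using hy)

/-- Every vertex starts a shortest closed walk using both types of arcs, with its steps of `B`
first. -/
theorem exists_mixed_segment (h : Γ.IsShiftFork σ B p q) [Nonempty V] {M i j : ℕ}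
    (hj : 1 ≤ j) (hij : i + j = M) (hc : ClosedShape σ B i j) (x : V) :
    ∃ k y z, i + (k + 2) = M ∧ B x y ∧ B y z ∧ StepWalk B k ((σ ^ i) z) x := by
  have hj2 : 2 ≤ j := by
    by_contra hlt
    obtain rfl : j = 1 := by omega
    exact h.not_closedShape_one i hc
  obtain ⟨k, rfl⟩ := Nat.exists_eq_add_of_le' hj2
  obtain ⟨u, rfl⟩ := (σ ^ i).surjective x
  obtain ⟨y, hy, z, hz, hw⟩ := hc u
  exact ⟨k, y, z, hij, hy, hz, (h.stepWalk_pow_iff i).2 hw⟩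

section NotInSquare

variable (hA : ∀ x y, B x y → ¬ B y (σ x)) (hF : ∀ x y z, B x y → B y z → ¬ B (σ x) z)

theorem closedShape_segment (h : Γ.IsShiftFork σ B p q) {i k : ℕ} {x z : V} {j : ℕ}
    (hxz : StepWalk B j x z) (hw : StepWalk B k ((σ ^ i) z) x) : ClosedShape σ B i (j + k) := by
  refine h.closedShape_of_stepWalk (x := x) (StepWalk.trans ?_ hw)
  exact (h.stepWalk_pow_iff i).2 hxz

include hA in
/-- Two consecutive steps of `B` in a shortest closed walk using both types of arcs are not
replaceable by fewer steps. -/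
theorem dist_eq_two_of_segment (h : Γ.IsShiftFork σ B p q) {M i k : ℕ}
    (hM : IsMixedLength σ B M) {x y z : V} (hxy : B x y) (hyz : B y z)
    (hi : 1 ≤ i) (hik : i + (k + 2) = M) (hw : StepWalk B k ((σ ^ i) z) x) :
    Γ.dist x z = 2 ∧ ¬ B x z := by
  have hnB : ¬ B x z := fun hxz => by
    have := hM.le hi (by omega) (h.closedShape_segment (StepWalk.single hxz) hw)
    omega
  refine ⟨?_, hnB⟩
  have hle := ((h.fork_adj hxy).hasPath.trans (h.fork_adj hyz).hasPath).dist_le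
  have h0 : Γ.dist x z ≠ 0 := fun e => by
    have := h.stronglyConnected.eq_of_dist_eq_zero e
    subst this
    exact h.asymm _ _ (h.fork_adj hxy) (h.fork_adj hyz)
  have h1 : Γ.dist x z ≠ 1 := fun e => by
    rcases (h.adj_iff x z).1 (h.stronglyConnected.adj_of_dist_eq_one e) with rfl | e
    · exact hA x y hxy hyz
    · exact hnB e
  omega

include hA hF in
/-- Two consecutive steps of `B` in a shortest closed walk using both types of arcs lie on a
shorter closed walk using `B` only: otherwise their two-way distance would be that of a step of
`σ` followed by a step of `B`. -/
theorem exists_pure_of_segment (h : Γ.IsShiftFork σ B p q) {M i k : ℕ}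
    (hM : IsMixedLength σ B M) {x y z : V} (hxy : B x y) (hyz : B y z)
    (hi : 1 ≤ i) (hik : i + (k + 2) = M) (hw : StepWalk B k ((σ ^ i) z) x) :
    ∃ l, l + 2 < M ∧ StepWalk B l z x := by
  have h2 := (dist_eq_two_of_segment hA h hM hxy hyz hi hik hw).1
  have h3 := h.dist_le_of_stepWalk hw
  have h4 : Γ.dist z x + 2 ≠ M := fun e => hF x y z hxy hyz (h.fork_of_dist hM h2 e)
  have hxz : StepWalk B 2 x z := ⟨y, hxy, z, hyz, rfl⟩
  obtain ⟨a, b, hab, hw', hc⟩ := h.exists_closedShape (a := 0) hxz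
  have ha : a = 0 := by
    by_contra ha
    have := hM.le (by omega) (by omega) hc
    omega
  subst ha
  exact ⟨b, by omega, hw'⟩

include hA hF in
theorem exists_isPureLength_lt (h : Γ.IsShiftFork σ B p q) [Nonempty V] {M : ℕ}
    (hM : IsMixedLength σ B M) : ∃ l < M, IsPureLength σ B l := by
  obtain ⟨i, j, hi, hj, hij, hc⟩ := hM.1
  obtain ⟨x⟩ := ‹Nonempty V›
  have : Nonempty V := ⟨x⟩
  obtain ⟨k, y, z, hk, hxy, hyz, hw⟩ := h.exists_mixed_segment hj hij hc x
  obtain ⟨l, hl, hw'⟩ := exists_pure_of_segment hA hF h hM hxy hyz hi hk hw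
  have hxz : StepWalk B 2 x z := ⟨y, hxy, z, hyz, rfl⟩
  obtain ⟨l', hl', hp⟩ := exists_isPureLength (σ := σ) (B := B) (L := 2 + l) (by omega)
    (h.closedShape_of_stepWalk (x := x) (i := 0) (hxz.trans hw'))
  exact ⟨l', by omega, hp⟩

include hA in
/-- A step of `σ` followed by two steps of `B` on a shortest closed walk using both types of arcs:
the only possible shortcuts use `B` only. -/
theorem shortcut_of_shift_segment (h : Γ.IsShiftFork σ B p q) [Nonempty V] {M i k : ℕ}
    (hM : IsMixedLength σ B M) {u y z : V} (hxy : B (σ u) y) (hyz : B y z)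
    (hi : 1 ≤ i) (hik : i + (k + 2) = M) (hw : StepWalk B k ((σ ^ i) z) (σ u))
    (hd : Γ.dist u z ≤ 2) : B u z ∨ ∃ w, B u w ∧ B w z := by
  obtain ⟨h2, hnB⟩ := dist_eq_two_of_segment hA h hM hxy hyz hi hik hw
  obtain ⟨a, b, hab, hw'⟩ := h.exists_stepWalk u z
  have h4 := h.four_le_mixed hM
  match a, b, hab, hw' with
  | 0, 0, _, hw' =>
    obtain rfl : u = z := hw'
    have : ClosedShape σ B 1 2 := h.closedShape_of_stepWalk (x := u) ⟨y, by simpa using hxy, u, hyz, rfl⟩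
    have := hM.le (by omega) (by omega) this
    omega
  | 1, 0, _, hw' =>
    obtain rfl : σ u = z := hw'
    rw [dist_self] at h2
    omega
  | 2, 0, _, hw' =>
    obtain rfl : σ (σ u) = z := hw'
    exact absurd hyz (hA _ _ hxy)
  | 0, 1, _, ⟨w, hs, e⟩ =>
    obtain rfl : w = z := e
    exact Or.inl hs
  | 1, 1, _, ⟨w, hs, e⟩ =>
    obtain rfl : w = z := e
    exact absurd (by simpa using hs) hnB
  | 0, 2, _, ⟨w, hs, w', hs', e⟩ =>
    obtain rfl : w' = z := e
    exact Or.inr ⟨w, hs, hs'⟩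
  | a + 3, b, hab, _ => omega
  | a, b + 3, hab, _ => omega
  | a + 1, b + 2, hab, _ => omega
  | a + 2, b + 1, hab, _ => omega

/-- Two steps of `σ` followed by a step of `B`: the only possible shortcuts use `B` only. -/
theorem shortcut_of_shift_shift_fork (h : Γ.IsShiftFork σ B p q) {v y : V}
    (hxy : B (σ (σ v)) y) (hd : Γ.dist v y ≤ 2) : B v y ∨ ∃ w, B v w ∧ B w y := by
  obtain ⟨a, b, hab, hw'⟩ := h.exists_stepWalk v y
  match a, b, hab, hw' with
  | a, 0, _, hw' =>
    obtain rfl : (σ ^ a) v = y := hw'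
    have := h.not_fork_zpow (σ (σ v)) (a - 2)
    rw [show σ (σ v) = (σ ^ (2 : ℤ)) v from rfl, ← Equiv.Perm.mul_apply, ← zpow_add,
      sub_add_cancel, zpow_natCast] at this
    exact absurd hxy this
  | 0, 1, _, ⟨w, hs, e⟩ =>
    obtain rfl : w = y := e
    exact Or.inl hs
  | 1, 1, _, ⟨w, hs, e⟩ =>
    obtain rfl : w = y := e
    exact absurd hxy (h.fork_shift_left_disjoint (by simpa using hs))
  | 0, 2, _, ⟨w, hs, w', hs', e⟩ =>
    obtain rfl : w' = y := e
    exact Or.inr ⟨w, hs, hs'⟩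
  | a, b + 3, hab, _ => omega
  | a + 1, b + 2, hab, _ => omega
  | a + 2, b + 1, hab, _ => omega

include hA in
/-- If a shift followed by two forks on a shortest mixed closed walk has no shortcut, then its
two-way distance is `(3, M - 3)`. -/
theorem dist_shift_segment (h : Γ.IsShiftFork σ B p q) [Nonempty V] {M i k : ℕ}
    (hM : IsMixedLength σ B M) {u y z : V} (hxy : B (σ u) y) (hyz : B y z)
    (hi : 1 ≤ i) (hik : i + (k + 2) = M) (hw : StepWalk B k ((σ ^ i) z) (σ u))
    (h1 : ¬ B u z) (h2 : ∀ w, B u w → ¬ B w z) : Γ.dist u z = 3 ∧ Γ.dist z u + 3 = M := by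
  constructor
  · apply le_antisymm
    · exact (((h.shift_adj u).hasPath.trans (h.fork_adj hxy).hasPath).trans
        (h.fork_adj hyz).hasPath).dist_le
    · by_contra hlt
      rcases shortcut_of_shift_segment hA h hM hxy hyz hi hik hw (by omega) with e | ⟨w, e, e'⟩
      · exact h1 e
      · exact h2 w e e'
  · apply le_antisymm
    · obtain ⟨i, rfl⟩ := Nat.exists_eq_add_of_le' hi
      rw [pow_succ'] at hw
      have hw' : StepWalk B k ((σ ^ i) z) u := by
        have := h.stepWalk_pow_iff 1 (j := k) (x := (σ ^ i) z) (y := u)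
        exact this.1 (by simpa using hw)
      have := h.dist_le_of_stepWalk hw'
      omega
    · obtain ⟨a, b, hab, -, hc⟩ := h.exists_closedShape (a := 1) (b := 2) (x := u) (z := z)
        ⟨y, by simpa using hxy, z, hyz, rfl⟩
      have := hM.le (by omega) (by omega) hc
      omega

include hA hF in
/-- If a shortest closed walk using both types of arcs has at least two steps of `σ`, then a step of
`σ` followed by two steps of `B`, or two steps of `σ` followed by a step of `B`, has a shortcut;
otherwise both would have two-way distance `(3, M - 3)`. -/
theorem exists_shortcut (h : Γ.IsShiftFork σ B p q) [Nonempty V] {M i k : ℕ}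
    (hM : IsMixedLength σ B M) {v y z : V} (hxy : B (σ (σ v)) y) (hyz : B y z)
    (hi : 2 ≤ i) (hik : i + (k + 2) = M) (hw : StepWalk B k ((σ ^ i) z) (σ (σ v))) :
    (B (σ v) z ∨ ∃ w, B (σ v) w ∧ B w z) ∨ B v y ∨ ∃ w, B v w ∧ B w y := by
  by_contra hcon
  push Not at hcon
  obtain ⟨⟨h1, h2⟩, h3, h4⟩ := hcon
  obtain ⟨h5, h6⟩ := dist_shift_segment hA h hM hxy hyz (by omega) hik hw h1 h2
  have h7 : Γ.dist v y = 3 := by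
    apply le_antisymm
    · exact (((h.shift_adj v).hasPath.trans (h.shift_adj _).hasPath).trans
        (h.fork_adj hxy).hasPath).dist_le
    · by_contra hlt
      rcases h.shortcut_of_shift_shift_fork hxy (by omega) with e | ⟨w, e, e'⟩
      · exact h3 e
      · exact h4 w e e'
  have h8 : Γ.dist y v + 3 = M := by
    apply le_antisymm
    · obtain ⟨i, rfl⟩ := Nat.exists_eq_add_of_le' hi
      have hw' : StepWalk B k ((σ ^ i) z) v := by
        have := h.stepWalk_pow_iff 2 (j := k) (x := (σ ^ i) z) (y := v)
        refine this.1 ?_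
        rw [← Equiv.Perm.mul_apply, ← pow_add, add_comm]
        exact hw
      have := h.dist_le_of_stepWalk (i := i) (j := 1 + k)
        (((StepWalk.single ((h.fork_pow_iff i).2 hyz))).trans hw')
      omega
    · obtain ⟨a, b, hab, -, hc⟩ := h.exists_closedShape (a := 2) (b := 1) (x := v) (z := y)
        ⟨y, hxy, rfl⟩
      have := hM.le (by omega) (by omega) hc
      omega
  have h9 : Γ.twoWayDist v y = Γ.twoWayDist (σ v) z := by
    simp only [twoWayDist, Prod.mk.injEq]
    omega
  exact hF _ _ _ hxy hyz (h.coherent_shift_left h.coherent_fork 2 h9 hxy)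

end NotInSquare

end IsShiftFork

end Digraph

namespace Digraph

/-! ### Twins: vertices with the same out-neighbours -/

section Twins

variable {V : Type*} {Γ : Digraph V}

/-- Having two distinct common neighbours with respect to coherent relations is coherent. -/
theorem Coherent.comp_two [Finite V] (h : Γ.IsWeaklyDistanceRegular) {P Q : V → V → Prop}
    (hP : Γ.Coherent P) (hQ : Γ.Coherent Q) :
    Γ.Coherent fun x y => ∃ z z', z ≠ z' ∧ P x z ∧ P x z' ∧ Q z y ∧ Q z' y := by
  rintro x y x' y' hxy ⟨z, z', hne, h1, h2, h3, h4⟩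
  obtain ⟨φ, hφ⟩ := h.exists_perm hxy
  exact ⟨φ z, φ z', fun e => hne (φ.injective e), hP (hφ z).1.symm h1, hP (hφ z').1.symm h2,
    hQ (hφ z).2.symm h3, hQ (hφ z').2.symm h4⟩

/-- `τ` sends each vertex to the only other vertex with the same out-neighbours, which is also the
only other vertex with the same in-neighbours. -/
structure IsTwinMap (B : V → V → Prop) (τ : V → V) : Prop where
  ne : ∀ x, τ x ≠ x
  left : ∀ {x y}, B x y → B (τ x) y
  right : ∀ {x y}, B x y → B x (τ y)
  eq_or_eq_in : ∀ {x u y}, B x y → B u y → u = x ∨ u = τ x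
  eq_or_eq_out : ∀ {x y y'}, B x y → B x y' → y' = y ∨ y' = τ y

theorem IsTwinMap.stepWalk {B : V → V → Prop} {τ : V → V} (hτ : IsTwinMap B τ) {j : ℕ} {x z : V}
    (hw : StepWalk B (j + 1) x z) : StepWalk B (j + 1) (τ x) z := by
  obtain ⟨y, hy, hw⟩ := hw
  exact ⟨y, hτ.left hy, hw⟩

theorem IsTwinMap.eq_or_eq {B : V → V → Prop} {τ : V → V} (hτ : IsTwinMap B τ) {j : ℕ} {x z z' : V}
    (hw : StepWalk B j x z) (hw' : StepWalk B j x z') : z' = z ∨ z' = τ z := by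
  induction j generalizing z z' with
  | zero => exact Or.inl (hw'.symm.trans hw)
  | succ j ih =>
    obtain ⟨y, hy, hyz⟩ := hw.exists_last
    obtain ⟨y', hy', hyz'⟩ := hw'.exists_last
    rcases ih hy hy' with rfl | rfl
    · exact hτ.eq_or_eq_out hyz hyz'
    · exact hτ.eq_or_eq_out (hτ.left hyz) hyz'

end Twins

namespace IsShiftFork

variable {V : Type*} {Γ : Digraph V} {σ : Equiv.Perm V} {B : V → V → Prop} {p q : ℕ}

theorem twin_twin (h : Γ.IsShiftFork σ B p q) {τ : V → V} (hτ : IsTwinMap B τ) (x : V) : τ (τ x) = x := by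
  obtain ⟨y, hy⟩ := h.exists_fork x
  exact ((hτ.eq_or_eq_in (hτ.left hy) hy).resolve_left (hτ.ne x).symm).symm

/-- A set of vertices closed under out-neighbours is everything. -/
theorem mem_of_closed (h : Γ.IsShiftFork σ B p q) {S : Set V} {x₀ : V} (h0 : x₀ ∈ S)
    (h1 : ∀ x ∈ S, σ x ∈ S) (h2 : ∀ x ∈ S, ∀ y, B x y → y ∈ S) (y : V) : y ∈ S := by
  have key : ∀ r x, x ∈ S → Γ.HasPath r x y → y ∈ S := by
    intro r
    induction r with
    | zero => intro x hx hp; rwa [← hasPath_zero.1 hp]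
    | succ r ih =>
      intro x hx hp
      obtain ⟨z, hz, hp⟩ := hasPath_succ.1 hp
      refine ih z ?_ hp
      rcases (h.adj_iff x z).1 hz with rfl | hxz
      exacts [h1 x hx, h2 x hx z hxz]
  exact key _ x₀ h0 (h.stronglyConnected.hasPath_dist x₀ y)

/-- If `σ ^ 2` is the twin map, then closed walks with less than `l` steps of `B` have none. -/
theorem not_closedShape_of_lt {τ : V → V} (hτ : IsTwinMap B τ) (h : Γ.IsShiftFork σ B p q) (hσ : ∀ x, τ x = σ (σ x)) {M l : ℕ}
    (hM : IsMixedLength σ B M) (hl : IsPureLength σ B l) (hlM : l < M) {d : ℕ} (hd : 1 ≤ d)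
    (hdl : d < l) (m : ℕ) : ¬ ClosedShape σ B m d := by
  obtain ⟨d, rfl⟩ := Nat.exists_eq_add_of_le' hd
  induction m using Nat.strong_induction_on with
  | _ m ih =>
    intro hc
    match m, ih, hc with
    | 0, _, hc =>
      have := hl.le hd hc
      omega
    | 1, _, hc =>
      have := hM.le le_rfl hd hc
      omega
    | m + 2, ih, hc =>
      refine ih m (by omega) fun x => ?_
      have := hτ.stepWalk (hc x)
      rw [hσ] at this
      have h4 : σ (σ ((σ ^ (m + 2)) x)) = (σ ^ m) x := by
        have e1 : (σ ^ (m + 2)) x = τ ((σ ^ m) x) := by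
          rw [hσ, add_comm, pow_add]
          rfl
        rw [← hσ, e1, h.twin_twin hτ]
      rwa [h4] at this

variable [Finite V]

theorem dist_of_same_out (h : Γ.IsShiftFork σ B p q) {u v y : V} (hu : B u y) (hv : B v y)
    (hall : ∀ z, B u z → B v z) (hne : ∀ k : ℤ, v ≠ (σ ^ k) u) : Γ.dist u v = q + 1 := by
  apply le_antisymm
  · have := ((h.fork_adj hu).hasPath.trans (h.stronglyConnected.hasPath_dist y v)).dist_le
    rw [h.dist_fork hv] at this
    omega
  · obtain ⟨i, j, hij, hw⟩ := h.exists_stepWalk u v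
    cases j with
    | zero =>
      obtain rfl : (σ ^ i) u = v := hw
      exact absurd (by simp) (hne i)
    | succ j =>
      obtain ⟨w, huw, hw⟩ := hw
      obtain ⟨z, rfl⟩ := (σ ^ i).surjective w
      have h1 := h.dist_le_of_stepWalk hw
      rw [h.dist_fork (hall z ((h.fork_pow_iff i).1 huw))] at h1
      omega

theorem dist_of_same_in (h : Γ.IsShiftFork σ B p q) {u v x : V} (hu : B x u) (hv : B x v)
    (hall : ∀ z, B z v → B z u) (hne : ∀ k : ℤ, v ≠ (σ ^ k) u) : Γ.dist u v = q + 1 := by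
  apply le_antisymm
  · have := ((h.stronglyConnected.hasPath_dist u x).trans (h.fork_adj hv).hasPath).dist_le
    rwa [h.dist_fork hu] at this
  · obtain ⟨i, j, hij, hw⟩ := h.exists_stepWalk u v
    cases j with
    | zero =>
      obtain rfl : (σ ^ i) u = v := hw
      exact absurd (by simp) (hne i)
    | succ j =>
      obtain ⟨z, hw, hz⟩ := hw.exists_last
      have h1 := h.dist_le_of_stepWalk hw
      rw [h.dist_fork (hall z hz)] at h1
      omega

/-- If two distinct vertices have the same out-neighbours, then each vertex has a twin. That a
pair with the same out-neighbours is at the same two-way distance as a pair with the same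
in-neighbours is seen as follows: either both are powers of the thin relation, the same one, or
the shortest paths between them start, respectively end, with an arc of `B`. -/
theorem exists_isTwinMap (h : Γ.IsShiftFork σ B p q) {x₀ x₁ y₀ y₁ : V} (hx : x₀ ≠ x₁)
    (hy : y₀ ≠ y₁) (h00 : B x₀ y₀) (h01 : B x₀ y₁) (h10 : B x₁ y₀) (h11 : B x₁ y₁) :
    ∃ τ, IsTwinMap B τ := by
  have hcoh := h.coherent_fork.comp_two h.wdr h.coherent_fork.swap
  have hex : ∀ x, ∃ x', x' ≠ x ∧ ∃ z z', z ≠ z' ∧ B x z ∧ B x z' ∧ B x' z ∧ B x' z' := by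
    intro x
    obtain ⟨x', hx'⟩ := (coherent_twoWayDist (Γ.twoWayDist x₀ x₁)).exists_right h.wdr rfl x
    refine ⟨x', fun e => hx ?_, hcoh hx'.symm ⟨y₀, y₁, hy, h00, h01, h10, h11⟩⟩
    exact h.stronglyConnected.eq_of_twoWayDist (u := x) (by rw [← hx', e])
  choose τ hne hτ using hex
  have left : ∀ {x y}, B x y → B (τ x) y := by
    intro x y hxy
    obtain ⟨z, z', hzz, h1, h2, h3, h4⟩ := hτ x
    rcases h.eq_or_eq_of_out h1 h2 hzz hxy with rfl | rfl
    exacts [h3, h4]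
  have hin : ∀ {x u y}, B x y → B u y → u = x ∨ u = τ x := fun {x u y} hxy huy =>
    h.eq_or_eq_of_in hxy (left hxy) (hne x).symm huy
  have htwo : ∀ {x y y'}, B x y → B x y' → y ≠ y' → y' = τ y := by
    intro x y y' hxy hxy' hyy
    -- the relation of `y` and `y'` is that of `x` and its twin
    have htw : Γ.twoWayDist x (τ x) = Γ.twoWayDist y y' := by
      by_cases hk : ∃ k : ℤ, y' = (σ ^ k) y
      · obtain ⟨k, rfl⟩ := hk
        have hB : B ((σ ^ k) x) ((σ ^ k) y) := (h.fork_zpow_iff k).2 hxy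
        rcases hin hxy' hB with e | e
        · exact absurd (by rw [h.zpow_eq_one e]; rfl) hyy
        · rw [← e]
          exact h.twoWayDist_zpow _ _ _
      · have hk' : ¬ ∃ k : ℤ, τ x = (σ ^ k) x := by
          rintro ⟨k, hk'⟩
          have h1 : B (τ x) ((σ ^ k) y) := hk' ▸ (h.fork_zpow_iff k).2 hxy
          rcases h.eq_or_eq_of_out (left hxy) (left hxy') hyy h1 with e | e
          · exact hne x (by rw [hk', h.zpow_eq_one e]; rfl)
          · exact hk ⟨k, e.symm⟩
        push Not at hk hk'
        have hinv : ∀ {a b : V}, (∀ k : ℤ, b ≠ (σ ^ k) a) → ∀ k : ℤ, a ≠ (σ ^ k) b := by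
          rintro a b hab k rfl
          exact hab (-k) (by simp [← Equiv.Perm.mul_apply])
        have hback : ∀ z, B (τ x) z → B x z := fun z hz => by
          rcases h.eq_or_eq_of_out (left hxy) (left hxy') hyy hz with rfl | rfl
          exacts [hxy, hxy']
        have hin' : ∀ {z}, B z y ↔ B z y' := fun {z} => by
          constructor
          · intro hz
            rcases hin hxy hz with rfl | rfl
            exacts [hxy', left hxy']
          · intro hz
            rcases hin hxy' hz with rfl | rfl
            exacts [hxy, left hxy]
        simp only [twoWayDist, Prod.mk.injEq]
        rw [h.dist_of_same_out hxy (left hxy) (fun _ => left) hk',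
          h.dist_of_same_out (left hxy) hxy hback (hinv hk'),
          h.dist_of_same_in hxy hxy' (fun _ => hin'.2) hk,
          h.dist_of_same_in hxy' hxy (fun _ => hin'.1) (hinv hk)]
        exact ⟨rfl, rfl⟩
    obtain ⟨z, z', hzz, h1, h2, h3, h4⟩ := hcoh htw (hτ x)
    exact ((hin h1 h3).resolve_left hyy.symm)
  have hout : ∀ {x y y'}, B x y → B x y' → y' = y ∨ y' = τ y := fun {x y y'} hxy hxy' => by
    by_cases e : y' = y
    · exact Or.inl e
    · exact Or.inr (htwo hxy hxy' (Ne.symm e))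
  refine ⟨τ, hne, left, fun {x y} hxy => ?_, hin, hout⟩
  obtain ⟨y', hyy, hxy', -⟩ := h.exists_other_out hxy
  rwa [← htwo hxy hxy' hyy.symm]

section TwinMap

variable {τ : V → V} (hτ : IsTwinMap B τ)

include hτ

theorem twin_shift (h : Γ.IsShiftFork σ B p q) (x : V) : τ (σ x) = σ (τ x) := by
  obtain ⟨y, hy⟩ := h.exists_fork x
  have h1 := hτ.eq_or_eq_in (h.fork_shift hy) (h.fork_shift (hτ.left hy))
  exact (h1.resolve_left fun e => hτ.ne x (σ.injective e)).symm

theorem not_fork_of_twins (h : Γ.IsShiftFork σ B p q) (x y z : V) (hxy : B x y) (hyz : B y z) :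
    ¬ B (σ x) z := by
  intro hB
  rcases hτ.eq_or_eq_in hyz hB with e | e
  · exact h.not_fork_shift x (e ▸ hxy)
  · exact h.not_fork_shift x (e ▸ hτ.right hxy)

variable (hA : ∀ x y, B x y → ¬ B y (σ x))

include hA in
/-- With twins, a step of `σ` cannot be inserted before two steps of `B` to give two steps of `B`,
and all shortest closed walks with both types of arcs have at least two steps of `σ`; then the twin
map is `σ ^ 2`. -/
theorem twin_eq_shift_shift (h : Γ.IsShiftFork σ B p q) {M : ℕ} (hM : IsMixedLength σ B M)
    (x : V) : τ x = σ (σ x) := by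
  have : Nonempty V := ⟨x⟩
  have hF := h.not_fork_of_twins hτ
  obtain ⟨l, hlM, hl⟩ := exists_isPureLength_lt hA hF h hM
  have hl1 := hl.1.1
  obtain ⟨i, j, hi, hj, hij, hc⟩ := hM.1
  rcases hi.eq_or_lt with rfl | hi
  · exfalso
    obtain ⟨r, rfl⟩ : ∃ r, j = l + r := ⟨j - l, by omega⟩
    obtain ⟨w, hw1, hw2⟩ := (hc x).exists_split
    have hw3 : StepWalk B l (σ x) (σ x) := hl.1.2 (σ x)
    have hw4 := hτ.eq_or_eq hw3 hw1
    cases r with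
    | zero =>
      obtain rfl : w = x := hw2
      rcases hw4 with e | e
      · exact h.shift_ne w e.symm
      · have e1 : τ w = σ w := by rw [e, h.twin_twin hτ, ← e]
        refine h.shift_shift_ne w ?_
        rw [← e1, ← h.twin_shift hτ, ← e]
    | succ r =>
      have hw5 : StepWalk B (r + 1) (σ x) x := by
        rcases hw4 with rfl | rfl
        · exact hw2
        · have := hτ.stepWalk hw2
          rwa [h.twin_twin hτ] at this
      have := hM.le le_rfl (by omega) (h.closedShape_of_stepWalk (i := 1) (x := x) hw5)
      omega
  · obtain ⟨k, y, z, hk, hxy, hyz, hw⟩ := h.exists_mixed_segment hj hij hc (σ (σ x))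
    have hshort := exists_shortcut hA hF h hM hxy hyz hi hk hw
    have key : B x y := by
      rcases hshort with (hs | ⟨w, hs, hs'⟩) | hs | ⟨w, hs, hs'⟩
      · exfalso
        rcases hτ.eq_or_eq_in hyz hs with e | e
        · exact h.asymm (σ (σ x)) (σ x) (h.fork_adj (e ▸ hxy)) (h.shift_adj _)
        · have hxy' := hτ.right hxy
          rw [← e] at hxy'
          exact h.asymm (σ (σ x)) (σ x) (h.fork_adj hxy') (h.shift_adj _)
      · exfalso
        refine h.fork_shift_left_disjoint ?_ hxy
        rcases hτ.eq_or_eq_in hyz hs' with rfl | rfl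
        · exact hs
        · rw [← h.twin_twin hτ y]
          exact hτ.right hs
      · exact hs
      · exfalso
        refine h.not_fork_zpow x 2 ?_
        change B x (σ (σ x))
        rcases hτ.eq_or_eq_in hxy hs' with rfl | rfl
        · exact hs
        · rw [← h.twin_twin hτ (σ (σ x))]
          exact hτ.right hs
    exact ((hτ.eq_or_eq_in key hxy).resolve_left (h.shift_shift_ne x)).symm

end TwinMap

section Lexicographic

variable {τ : V → V} (hτ : IsTwinMap B τ)

include hτ in
theorem pure_ne_four (h : Γ.IsShiftFork σ B p q) [Nonempty V] (hσ : ∀ x, τ x = σ (σ x)) {M l : ℕ}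
    (hM : IsMixedLength σ B M) (hl : IsPureLength σ B l) (hlM : l < M) : l ≠ 4 := by
  rintro rfl
  have h4 : ∀ x, σ (σ (σ (σ x))) = x := fun x => by rw [← hσ, ← hσ, h.twin_twin hτ]
  have h1 : p + 1 ≤ 4 := h.shift_le (i := 4) (j := 0) (by omega) fun x => h4 x
  have h2 : q + 1 ≤ 4 := h.fork_le hl.1.1 hl.1.2
  have hp2 := h.two_le_shift
  have hp3 : p = 3 := by
    obtain ⟨i, j, hij, hc⟩ := h.exists_closedShape_shift
    have hj : j = 0 := by
      by_contra hj
      have := hM.le (by omega) (by omega) hc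
      omega
    subst hj
    by_contra hne
    obtain rfl : i = 2 := by omega
    obtain ⟨x⟩ := ‹Nonempty V›
    have h3 : σ (σ (σ x)) = x := hc x
    have := h4 x
    rw [h3] at this
    exact h.shift_ne x this
  have hq3 : q = 3 := by
    obtain ⟨i, j, hij, hc⟩ := h.exists_closedShape_fork
    have hi : i = 0 := by
      by_contra hi
      have := hM.le (by omega) (by omega) hc
      omega
    subst hi
    have := hl.le (by omega) hc
    omega
  exact h.ne (hp3.trans hq3.symm)

include hτ in
/-- If `σ ^ 2` is the twin map, then the digraph is the Cayley digraph of `ℤ₄ × ℤ_l`. -/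
theorem isIsomorphic_addCayley (h : Γ.IsShiftFork σ B p q) (x₀ : V)
    (hσ : ∀ x, τ x = σ (σ x)) {M l : ℕ}
    (hM : IsMixedLength σ B M) (hl : IsPureLength σ B l) (hlM : l < M) :
    Γ.IsIsomorphic (addCayley (ZMod 4 × ZMod l) {(0, 1), (2, 1), (1, 0)}) := by
  have hV : Nonempty V := ⟨x₀⟩
  have hl3 := h.three_le_pure hl
  have : NeZero l := ⟨by omega⟩
  have : Fact (1 < l) := ⟨by omega⟩
  have h4 : σ ^ 4 = 1 := Equiv.ext fun x => by
    change σ (σ (σ (σ x))) = x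
    rw [← hσ, ← hσ, h.twin_twin hτ]
  choose b hb using h.exists_fork
  have hBb : ∀ x y, B x y ↔ y = b x ∨ y = (σ ^ 2) (b x) := fun x y => by
    constructor
    · intro hy
      rcases hτ.eq_or_eq_out (hb x) hy with e | e
      · exact Or.inl e
      · exact Or.inr (by rw [e, hσ]; rfl)
    · rintro (rfl | rfl)
      · exact hb x
      · have := hτ.right (hb x)
        rwa [hσ] at this
  have hwalk : ∀ c x, StepWalk B c x (b^[c] x) := by
    intro c
    induction c with
    | zero => exact fun x => rfl
    | succ c ih => exact fun x => ⟨b x, hb x, ih (b x)⟩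
  have hsplit : ∀ c d x, StepWalk B d (b^[c] x) (b^[c + d] x) := fun c d x => by
    rw [add_comm, Function.iterate_add_apply]
    exact hwalk _ _
  let f : ZMod 4 × ZMod l → V := fun u => (σ ^ u.1.val) (b^[u.2.val] x₀)
  have hf1 : ∀ a c, f (a + 1, c) = σ (f (a, c)) := by
    intro a c
    have : σ ^ (a + 1).val = σ ^ (a.val + 1) := by
      rw [ZMod.val_add, pow_eq_pow_mod (a.val + 1) h4]
      rfl
    simp only [f, this, pow_succ']
    rfl
  have hf2 : ∀ a c, f (a + 2, c) = (σ ^ 2) (f (a, c)) := by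
    intro a c
    rw [show a + 2 = a + 1 + 1 by ring, hf1, hf1]
    rfl
  have hfB : ∀ a c y, B (f (a, c)) y ↔ y = f (a, c + 1) ∨ y = f (a + 2, c + 1) := by
    intro a c y
    have key : f (a, c + 1) = (σ ^ a.val) (b (b^[c.val] x₀)) ∨
        f (a, c + 1) = (σ ^ 2) ((σ ^ a.val) (b (b^[c.val] x₀))) := by
      rw [← Function.iterate_succ_apply' b]
      by_cases hc : c.val + 1 < l
      · left
        have : (c + 1).val = c.val + 1 := by
          rw [ZMod.val_add, ZMod.val_one, Nat.mod_eq_of_lt hc]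
        simp only [f, this]
      · have hcl : c.val + 1 = l := by
          have := c.val_lt
          omega
        have : (c + 1).val = 0 := by
          rw [ZMod.val_add, ZMod.val_one, hcl, Nat.mod_self]
        have h1 : StepWalk B l x₀ x₀ := hl.1.2 x₀
        simp only [f, this, Function.iterate_zero, id_eq, Nat.succ_eq_add_one, hcl]
        rcases hτ.eq_or_eq (hwalk l x₀) h1 with e | e
        · left
          rw [← e]
        · right
          rw [hσ] at e
          conv_lhs => rw [e]
          change (σ ^ a.val) ((σ ^ 2) _) = _
          rw [← Equiv.Perm.mul_apply, ← Equiv.Perm.mul_apply, ← pow_add, ← pow_add, add_comm]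
    have hB : ∀ y, B (f (a, c)) y ↔ y = (σ ^ a.val) (b (b^[c.val] x₀)) ∨
        y = (σ ^ 2) ((σ ^ a.val) (b (b^[c.val] x₀))) := by
      intro y
      obtain ⟨y, rfl⟩ := (σ ^ a.val).surjective y
      rw [h.fork_pow_iff, hBb, ← Equiv.Perm.mul_apply (σ ^ 2), ← pow_add, add_comm 2, pow_add,
        Equiv.Perm.mul_apply, EmbeddingLike.apply_eq_iff_eq, EmbeddingLike.apply_eq_iff_eq]
    rw [hB, hf2]
    rcases key with e | e
    · rw [e]
    · rw [e, or_comm, ← Equiv.Perm.mul_apply (σ ^ 2) (σ ^ 2), ← pow_add, h4]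
      rfl
  have hsurj : Function.Surjective f := fun y => by
    refine h.mem_of_closed (S := Set.range f) (x₀ := x₀) ⟨(0, 0), by simp [f]⟩ ?_ ?_ y
    · rintro _ ⟨⟨a, c⟩, rfl⟩
      exact ⟨_, hf1 a c⟩
    · rintro _ ⟨⟨a, c⟩, rfl⟩ z hz
      rcases (hfB a c z).1 hz with rfl | rfl
      exacts [⟨_, rfl⟩, ⟨_, rfl⟩]
  have hinj' : ∀ u v : ZMod 4 × ZMod l, u.2.val ≤ v.2.val → f u = f v → u = v := by
    rintro ⟨a, c⟩ ⟨a', c'⟩ hle he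
    obtain ⟨d, hd⟩ := Nat.exists_eq_add_of_le hle
    dsimp only at hd
    have hlt := c'.val_lt
    have hw := hsplit c.val d x₀
    rw [← hd] at hw
    have hw' := (h.stepWalk_pow_iff a'.val).2 hw
    change StepWalk B d _ (f (a', c')) at hw'
    rw [← he] at hw'
    have hd0 : d = 0 := by
      by_contra hd0
      refine not_closedShape_of_lt hτ h hσ hM hl hlM (d := d) (by omega) (by omega)
        (a'.val + (4 - a.val)) (h.closedShape_of_stepWalk (x := (σ ^ a.val) (b^[c.val] x₀)) ?_)
      have ha := a.val_lt
      rw [← Equiv.Perm.mul_apply, ← pow_add, add_assoc, Nat.sub_add_cancel ha.le, pow_add, h4]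
      exact hw'
    subst hd0
    have hcc : c = c' := ZMod.val_injective l (by omega)
    subst hcc
    have haa : (σ ^ a.val) (b^[c.val] x₀) = (σ ^ a'.val) (b^[c.val] x₀) := he
    have hz : (σ ^ ((a.val : ℤ) - a'.val)) (b^[c.val] x₀) = b^[c.val] x₀ := by
      rw [sub_eq_neg_add, zpow_add, zpow_natCast, Equiv.Perm.mul_apply, haa,
        ← Equiv.Perm.mul_apply, ← zpow_natCast, ← zpow_add]
      simp
    have hz1 := h.zpow_eq_one hz
    have ho : orderOf σ = 4 := by
      refine orderOf_eq_prime_pow (p := 2) (n := 1) (fun e => ?_) h4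
      have : σ (σ x₀) = x₀ := Equiv.congr_fun e x₀
      exact h.shift_shift_ne x₀ this
    rw [← orderOf_dvd_iff_zpow_eq_one, ho] at hz1
    have h1 := a.val_lt
    have h2 := a'.val_lt
    have h3 : a.val = a'.val := by
      obtain ⟨k, hk⟩ := hz1
      push_cast at hk
      omega
    rw [ZMod.val_injective 4 h3]
  have hinj : Function.Injective f := fun u v he => by
    rcases le_total u.2.val v.2.val with hle | hle
    · exact hinj' u v hle he
    · exact (hinj' v u hle he.symm).symm
  let e : ZMod 4 × ZMod l ≃ V := Equiv.ofBijective f ⟨hinj, hsurj⟩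
  refine ⟨RelIso.symm ⟨e, ?_⟩⟩
  rintro ⟨a, c⟩ ⟨a', c'⟩
  change Γ.Adj (f (a, c)) (f (a', c')) ↔ _
  rw [h.adj_iff, hfB, ← hf1, hinj.eq_iff, hinj.eq_iff, hinj.eq_iff]
  simp only [addCayley, Set.mem_insert_iff, Set.mem_singleton_iff, exists_eq_or_imp,
    exists_eq_left, Prod.mk_add_mk, add_comm, add_zero]
  tauto

end Lexicographic

end IsShiftFork

end Digraph

namespace Digraph

/-! ### Absence of twins -/

section NoTwins

variable {V : Type*}

/-- Distinct vertices have at most one common out-neighbour. -/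
def NoTwins (B : V → V → Prop) : Prop :=
  ∀ ⦃x x' y y' : V⦄, x ≠ x' → y ≠ y' → B x y → B x y' → B x' y → ¬ B x' y'

/-- The two out-neighbours of each vertex `x` have the common out-neighbour `T x`. -/
structure IsApexMap (B : V → V → Prop) (T : V → V) : Prop where
  out : ∀ {x y}, B x y → B y (T x)
  mem_in : ∀ {x y}, B y (T x) → B x y
  eq_of_out : ∀ {x y z z'}, B x y → B y z → B y z' → z ≠ T x → z' ≠ T x → z = z'
  ne_of_ne : ∀ {x y y' z z'}, B x y → B x y' → y ≠ y' → B y z → B y' z' → z ≠ T x → z' ≠ z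

/-- `z` is reached from `x` by two steps of `B`, but is not the apex over `x`. -/
def Straight (B : V → V → Prop) (T : V → V) (x z : V) : Prop :=
  z ≠ T x ∧ ∃ y, B x y ∧ B y z

end NoTwins

namespace IsShiftFork

variable {V : Type*} {Γ : Digraph V} {σ : Equiv.Perm V} {B : V → V → Prop} {p q : ℕ}

section ApexMap

variable {T : V → V} (hT : IsApexMap B T)

include hT

theorem apex_unique (h : Γ.IsShiftFork σ B p q) {x z : V} (hz : ∀ y, B x y → B y z) :
    z = T x := by
  obtain ⟨y, hxy⟩ := h.exists_fork x
  obtain ⟨y', hyy, hxy', -⟩ := h.exists_other_out hxy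
  by_contra hne
  exact hT.ne_of_ne hxy hxy' hyy.symm (hz y hxy) (hz y' hxy') hne rfl

/-- Every arc continues straight in exactly one way. -/
theorem exists_straight (h : Γ.IsShiftFork σ B p q) {x y : V} (hxy : B x y) :
    ∃ z, B y z ∧ z ≠ T x := by
  obtain ⟨z, hz, hyz, -⟩ := h.exists_other_out (hT.out hxy)
  exact ⟨z, hyz, hz⟩

theorem straight_three (h : Γ.IsShiftFork σ B p q) {x a b c : V} (ha : Straight B T x a)
    (hb : Straight B T x b) (hc : Straight B T x c) : a = b ∨ a = c ∨ b = c := by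
  obtain ⟨ha, y, hy, hya⟩ := ha
  obtain ⟨hb, y', hy', hyb⟩ := hb
  obtain ⟨hc, y'', hy'', hyc⟩ := hc
  by_cases e : y = y'
  · subst e
    exact Or.inl (hT.eq_of_out hy hya hyb ha hb)
  · rcases h.eq_or_eq_of_out hy hy' e hy'' with rfl | rfl
    · exact Or.inr (Or.inl (hT.eq_of_out hy hya hyc ha hc))
    · exact Or.inr (Or.inr (hT.eq_of_out hy' hyb hyc hb hc))

theorem exists_other_straight (h : Γ.IsShiftFork σ B p q) {x z : V} (hxz : Straight B T x z) :
    ∃ z', z' ≠ z ∧ Straight B T x z' := by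
  obtain ⟨hne, y, hxy, hyz⟩ := hxz
  obtain ⟨y', hyy, hxy', -⟩ := h.exists_other_out hxy
  obtain ⟨z', hyz', hne'⟩ := h.exists_straight hT hxy'
  exact ⟨z', hT.ne_of_ne hxy hxy' hyy.symm hyz hyz' hne, hne', y', hxy', hyz'⟩

end ApexMap

variable [Finite V]

/-- All pairs of distinct vertices with a common out-neighbour are at the same two-way distance. -/
theorem twoWayDist_common_out (h : Γ.IsShiftFork σ B p q) {x x' y u u' w : V} (hx : x ≠ x')
    (hxy : B x y) (hxy' : B x' y) (huw : B u w) (hu : u ≠ u') (huw' : B u' w) :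
    Γ.twoWayDist x x' = Γ.twoWayDist u u' := by
  obtain ⟨c, hc, hcw⟩ := (coherent_twoWayDist (Γ.twoWayDist x x')).comp h.wdr h.coherent_fork
    (h.twoWayDist_fork hxy huw) ⟨x', rfl, hxy'⟩
  rcases h.eq_or_eq_of_in huw huw' hu hcw with rfl | rfl
  · exact absurd (h.stronglyConnected.eq_of_twoWayDist hc.symm) hx
  · exact hc.symm

/-- All pairs of distinct vertices with a common in-neighbour are at the same two-way distance. -/
theorem twoWayDist_common_in (h : Γ.IsShiftFork σ B p q) {x y y' u v v' : V} (hy : y ≠ y')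
    (hxy : B x y) (hxy' : B x y') (huv : B u v) (hv : v ≠ v') (huv' : B u v') :
    Γ.twoWayDist y y' = Γ.twoWayDist v v' := by
  obtain ⟨c, huc, hc⟩ := h.coherent_fork.comp h.wdr (coherent_twoWayDist (Γ.twoWayDist y y'))
    (h.twoWayDist_fork hxy' huv') ⟨y, hxy, rfl⟩
  rcases h.eq_or_eq_of_out huv huv' hv huc with rfl | rfl
  · exact hc.symm
  · exact absurd (h.stronglyConnected.eq_of_twoWayDist hc.symm) hy

theorem ne_zpow_of_common_out (h : Γ.IsShiftFork σ B p q) (hN : NoTwins B) {x x' y : V}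
    (hx : x ≠ x') (hxy : B x y) (hxy' : B x' y) (k : ℤ) : x' ≠ (σ ^ k) x := by
  rintro rfl
  obtain ⟨y', hyy, hy', -⟩ := h.exists_other_out hxy
  obtain ⟨c, hc, hcy, -⟩ := h.exists_other_in hy'
  have := h.twoWayDist_common_out hc.symm hy' hcy hxy hx hxy'
  rw [h.eq_zpow_of_twoWayDist this] at hcy
  exact hN hx hyy.symm hxy hy' hxy' hcy

theorem ne_zpow_of_common_in (h : Γ.IsShiftFork σ B p q) (hN : NoTwins B) {x y y' : V}
    (hy : y ≠ y') (hxy : B x y) (hxy' : B x y') (k : ℤ) : y' ≠ (σ ^ k) y := by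
  rintro rfl
  obtain ⟨x', hxx, hx', -⟩ := h.exists_other_in hxy
  obtain ⟨c, hc, hcx, -⟩ := h.exists_other_out hx'
  have := h.twoWayDist_common_in hc.symm hx' hcx hxy hy hxy'
  rw [h.eq_zpow_of_twoWayDist this] at hcx
  exact hN hxx.symm hy hxy hxy' hx' hcx

/-- The relation `B` is normal: distinct vertices with a common in-neighbour have a common
out-neighbour. Both relations have a single symmetric two-way distance; comparing shortest paths,
which by the absence of twins contain arcs of `B`, gives that these distances agree. -/
theorem exists_common_out (h : Γ.IsShiftFork σ B p q) (hN : NoTwins B) {x y y' : V}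
    (hy : y ≠ y') (hxy : B x y) (hxy' : B x y') : ∃ z, B y z ∧ B y' z := by
  obtain ⟨x', hx, hx', -⟩ := h.exists_other_in hxy
  have hsymO := h.twoWayDist_common_out hx.symm hxy hx' hx' hx hxy
  have hsymI := h.twoWayDist_common_in hy hxy hxy' hxy' hy.symm hxy
  have e1 : Γ.dist x x' ≤ q + 1 := by
    have := ((h.fork_adj hxy).hasPath.trans (h.stronglyConnected.hasPath_dist y x')).dist_le
    rw [h.dist_fork hx'] at this
    omega
  have e2 : Γ.dist y y' ≤ q + 1 := by
    have := ((h.stronglyConnected.hasPath_dist y x).trans (h.fork_adj hxy').hasPath).dist_le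
    rwa [h.dist_fork hxy] at this
  have e3 : Γ.dist y y' ≤ Γ.dist x x' := by
    obtain ⟨i, j, hij, hw⟩ := h.exists_stepWalk x x'
    cases j with
    | zero =>
      exact absurd (by simpa using hw.symm) (h.ne_zpow_of_common_out hN hx.symm hxy hx' i)
    | succ j =>
      obtain ⟨w, hxw, hw⟩ := hw
      obtain ⟨z, rfl⟩ := (σ ^ i).surjective w
      have hxz := (h.fork_pow_iff i).1 hxw
      have h1 := h.dist_le_of_stepWalk hw
      by_cases hz : B x' z
      · rw [h.dist_fork hz] at h1
        omega
      · obtain rfl : z = y' := (h.eq_or_eq_of_out hxy hxy' hy hxz).resolve_left fun e =>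
          hz (e ▸ hx')
        have h2 := ((h.stronglyConnected.hasPath_dist z x').trans (h.fork_adj hx').hasPath).dist_le
        have h3 : Γ.dist y z = Γ.dist z y := congrArg Prod.fst hsymI
        omega
  have e4 : Γ.dist x x' ≤ Γ.dist y y' := by
    obtain ⟨i, j, hij, hw⟩ := h.exists_stepWalk y y'
    cases j with
    | zero =>
      exact absurd (by simpa using hw.symm) (h.ne_zpow_of_common_in hN hy hxy hxy' i)
    | succ j =>
      obtain ⟨u, hw, hu⟩ := hw.exists_last
      have h1 := h.dist_le_of_stepWalk hw
      by_cases huy : B u y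
      · rw [h.dist_fork huy] at h1
        omega
      · have hux : x ≠ u := fun e => huy (e ▸ hxy)
        have h2 := ((h.fork_adj hxy).hasPath.trans (h.stronglyConnected.hasPath_dist y u)).dist_le
        have h3 : Γ.dist x x' = Γ.dist x u :=
          congrArg Prod.fst (h.twoWayDist_common_out hx.symm hxy hx' hxy' hux hu)
        omega
  have e5 : Γ.twoWayDist x x' = Γ.twoWayDist y y' := by
    have h1 : Γ.dist x x' = Γ.dist x' x := congrArg Prod.fst hsymO
    have h2 : Γ.dist y y' = Γ.dist y' y := congrArg Prod.fst hsymI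
    simp only [twoWayDist, Prod.mk.injEq]
    omega
  exact h.coherent_fork.comp h.wdr h.coherent_fork.swap e5 ⟨y, hxy, hx'⟩

theorem exists_isApexMap (h : Γ.IsShiftFork σ B p q) (hN : NoTwins B) : ∃ T, IsApexMap B T := by
  have hex : ∀ x, ∃ z, ∀ y, B x y → B y z := fun x => by
    obtain ⟨y, hxy⟩ := h.exists_fork x
    obtain ⟨y', hyy, hxy', hall⟩ := h.exists_other_out hxy
    obtain ⟨z, hz, hz'⟩ := h.exists_common_out hN hyy.symm hxy hxy'
    refine ⟨z, fun w hw => ?_⟩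
    rcases hall w hw with rfl | rfl
    exacts [hz, hz']
  choose T hT using hex
  refine ⟨T, fun {x y} => hT x y, fun {x y} hy => ?_, fun {x y z z'} hxy hz hz' hne hne' => ?_,
    fun {x y y' z z'} hxy hxy' hyy hz hz' hne e => ?_⟩
  · obtain ⟨u, hu⟩ := h.exists_fork x
    obtain ⟨u', huu, hu', -⟩ := h.exists_other_out hu
    rcases h.eq_or_eq_of_in (hT x u hu) (hT x u' hu') huu.symm hy with rfl | rfl
    exacts [hu, hu']
  · exact ((h.eq_or_eq_of_out (hT x y hxy) hz' (Ne.symm hne') hz).resolve_left hne)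
  · subst e
    exact hN hyy hne hz (hT x y hxy) hz' (hT x y' hxy')

section ApexMap

variable {T : V → V} (hT : IsApexMap B T)

include hT

theorem coherent_apex (h : Γ.IsShiftFork σ B p q) : Γ.Coherent fun x z => z = T x := by
  have key : ∀ x z, z = T x ↔ ∃ y y', y ≠ y' ∧ B x y ∧ B x y' ∧ B y z ∧ B y' z := fun x z => by
    constructor
    · rintro rfl
      obtain ⟨y, hxy⟩ := h.exists_fork x
      obtain ⟨y', hyy, hxy', -⟩ := h.exists_other_out hxy
      exact ⟨y, y', hyy.symm, hxy, hxy', hT.out hxy, hT.out hxy'⟩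
    · rintro ⟨y, y', hyy, hxy, hxy', hz, hz'⟩
      by_contra hne
      exact hT.ne_of_ne hxy hxy' hyy hz hz' hne rfl
  have := h.coherent_fork.comp_two h.wdr h.coherent_fork
  simpa only [← key] using this

theorem coherent_straight (h : Γ.IsShiftFork σ B p q) : Γ.Coherent (Straight B T) := by
  rintro x z x' z' hxz ⟨hne, hy⟩
  exact ⟨fun e => hne (h.coherent_apex hT hxz.symm e),
    h.coherent_fork.comp h.wdr h.coherent_fork hxz hy⟩

theorem twoWayDist_straight (h : Γ.IsShiftFork σ B p q) {x z x' z' : V}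
    (hxz : Straight B T x z) (hxz' : Straight B T x' z') :
    Γ.twoWayDist x z = Γ.twoWayDist x' z' := by
  obtain ⟨hne, y, hxy, hyz⟩ := hxz
  obtain ⟨hne', y', hxy', hyz'⟩ := hxz'
  obtain ⟨c, hc, hyc⟩ := (coherent_twoWayDist (Γ.twoWayDist x z)).comp h.wdr h.coherent_fork.swap
    (h.twoWayDist_fork hxy hxy') ⟨z, rfl, hyz⟩
  have hcT : c ≠ T x' := fun e => hne (h.coherent_apex hT hc e)
  rw [← hT.eq_of_out hxy' hyc hyz' hcT hne', hc]

/-- Coherent relations containing a straight pair are not thin. -/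
theorem exists_ne_of_straight (h : Γ.IsShiftFork σ B p q) {x z : V} (hxz : Straight B T x z)
    {P : V → V → Prop} (hP : Γ.Coherent P) (hz : P x z) : ∃ z', z' ≠ z ∧ P x z' := by
  obtain ⟨z', hne, hz'⟩ := h.exists_other_straight hT hxz
  exact ⟨z', hne, hP (h.twoWayDist_straight hT hxz hz') hz⟩

/-- If straight pairs are products of a power of `σ` and a step of `B`, then the apex map is the
square of that power. -/
theorem apex_eq_zpow (h : Γ.IsShiftFork σ B p q) {x z : V} {k : ℤ} (hxz : Straight B T x z)
    (hB : B ((σ ^ k) x) z) :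
    (∀ u, T u = (σ ^ (2 * k)) u) ∧ ∀ u w, Straight B T u w → B ((σ ^ k) u) w := by
  have hall : ∀ u w, Straight B T u w → B ((σ ^ k) u) w := fun u w huw =>
    h.coherent_shift_left h.coherent_fork k (h.twoWayDist_straight hT hxz huw) hB
  refine ⟨fun u => (h.apex_unique hT fun y hy => ?_).symm, hall⟩
  obtain ⟨w, hw, hne⟩ := h.exists_straight hT hy
  have h1 := hall u w ⟨hne, y, hy, hw⟩
  have h2 : (σ ^ k) u ≠ y := fun e => h.not_fork_zpow u k (e ▸ hy)
  have h3 := h.twoWayDist_common_out h2 h1 hw hw h2.symm h1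
  have h4 : B ((σ ^ (-k)) y) ((σ ^ k) u) := h.coherent_shift_left h.coherent_fork (-k) h3
    (by simpa [← Equiv.Perm.mul_apply] using hy)
  rw [← h.fork_zpow_iff k, ← Equiv.Perm.mul_apply, ← Equiv.Perm.mul_apply, ← zpow_add,
    ← zpow_add, ← two_mul] at h4
  simpa using h4

/-- The swap argument: a closed walk with at least three steps of `B` can be changed so as to
contain a straight pair. -/
theorem exists_straight_walk (h : Γ.IsShiftFork σ B p q) {i k : ℕ} {x y z : V} (hxy : B x y)
    (hyz : B y z) (hw : StepWalk B (k + 1) ((σ ^ i) z) x) :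
    ∃ x y z, B x y ∧ B y z ∧ z ≠ T x ∧ StepWalk B (k + 1) ((σ ^ i) z) x := by
  by_cases hz : z = T x
  · obtain ⟨w', hzw, hw⟩ := hw
    obtain ⟨w, rfl⟩ := (σ ^ i).surjective w'
    rw [h.fork_pow_iff] at hzw
    by_cases hwy : w = T y
    · obtain ⟨y', hyy, hxy', -⟩ := h.exists_other_out hxy
      refine ⟨y', z, w, hz ▸ hT.out hxy', hzw, fun e => ?_, hw.trans (StepWalk.single hxy')⟩
      obtain ⟨v, hv, hvne⟩ := h.exists_straight hT hxy
      have h1 : B v w := hwy ▸ hT.out hv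
      have h2 : B y' v := hT.mem_in (e ▸ h1)
      exact hT.ne_of_ne hxy hxy' hyy.symm hv h2 hvne rfl
    · exact ⟨y, z, w, hyz, hzw, hwy, hw.trans (StepWalk.single hxy)⟩
  · exact ⟨x, y, z, hxy, hyz, hz, hw⟩

end ApexMap

end IsShiftFork

end Digraph

namespace Digraph

/-! ### Without twins, the thin relation is contained in the square of the forked one -/

namespace IsShiftFork

variable {V : Type*} {Γ : Digraph V} {σ : Equiv.Perm V} {B : V → V → Prop} {p q : ℕ}
  {T : V → V} [Finite V]

/-- The product of the two arc relations is disjoint from the square of `B`: otherwise the apex map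
is `σ ^ 2`, and steps of the two kinds can be exchanged in shortest closed walks, which gives
`p = q`. -/
theorem not_fork_of_square (h : Γ.IsShiftFork σ B p q) (hT : IsApexMap B T)
    {x y z : V} (hxy : B x y) (hyz : B y z) : ¬ B (σ x) z := by
  intro hB
  have : Nonempty V := ⟨x⟩
  by_cases hz : z = T x
  · subst hz
    exact h.not_fork_shift x (hT.mem_in hB)
  · obtain ⟨hT2, hR⟩ := h.apex_eq_zpow hT (k := 1) ⟨hz, y, hxy, hyz⟩ (by simpa using hB)
    have hp2 := h.two_le_shift
    have hq2 := h.two_le_fork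
    have hTT : ∀ u, T u = σ (σ u) := fun u => hT2 u
    have hle : q ≤ p := by
      obtain ⟨i, j, hij, hc⟩ := h.exists_closedShape_shift
      rcases Nat.eq_zero_or_pos j with rfl | hj
      · obtain ⟨m, rfl⟩ : ∃ m, i = m + 1 := ⟨i - 1, by omega⟩
        have hc' : ClosedShape σ B m 2 := fun u => by
          obtain ⟨v, hv⟩ := h.exists_fork ((σ ^ m) u)
          refine ⟨v, hv, T ((σ ^ m) u), hT.out hv, ?_⟩
          have : (σ ^ (1 + (m + 1))) u = u := hc u
          rw [show 1 + (m + 1) = 2 + m by ring, pow_add] at this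
          rw [hTT]
          exact this
        have := h.fork_le (by omega) hc'
        omega
      · have := h.fork_le hj hc
        omega
    have hge : p ≤ q := by
      obtain ⟨i, j, hij, hc⟩ := h.exists_closedShape_fork
      rcases Nat.eq_zero_or_pos i with rfl | hi
      · obtain ⟨m, rfl⟩ : ∃ m, j = m + 1 := ⟨j - 1, by omega⟩
        rw [add_comm] at hc
        obtain ⟨v, hv, w, hw, hww⟩ := hc x
        by_cases hwT : w = T x
        · have hc' : ClosedShape σ B 2 m := h.closedShape_of_stepWalk (x := x) (by
            rw [hwT, hTT] at hww
            exact hww)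
          have := h.shift_le (by omega) hc'
          omega
        · have hc' : ClosedShape σ B 1 (m + 1) := h.closedShape_of_stepWalk (x := x)
            ⟨w, hR x w ⟨hwT, v, hv, hw⟩, hww⟩
          have := h.shift_le (by omega) hc'
          omega
      · have := h.shift_le hi hc
        omega
    exact h.ne (le_antisymm hge hle)

section NotInSquare

variable (hN : NoTwins B) (hA : ∀ x y, B x y → ¬ B y (σ x))

/-- A straight pair is not also obtained from a step of `σ⁻¹` followed by a step of `B`: otherwise
there would be a mixed closed walk of length four, and then `p = q = 2`. -/
theorem not_fork_of_straight (h : Γ.IsShiftFork σ B p q) (hT : IsApexMap B T)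
    (hA : ∀ x y, B x y → ¬ B y (σ x)) {u z : V} (hR : Straight B T (σ u) z) : ¬ B u z := by
  intro hB
  have : Nonempty V := ⟨u⟩
  obtain ⟨M, hM⟩ := h.exists_isMixedLength
  have hF : ∀ x y z, B x y → B y z → ¬ B (σ x) z := fun x y z => h.not_fork_of_square hT
  obtain ⟨l, hlM, hl⟩ := exists_isPureLength_lt hA hF h hM
  obtain ⟨hT2, hR2⟩ := h.apex_eq_zpow hT (k := -1) hR (by simpa using hB)
  have hTT : ∀ x, T (σ (σ x)) = x := fun x => by
    rw [hT2]
    change ((σ ^ (-2 : ℤ)) * (σ ^ (2 : ℤ))) x = x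
    simp
  have hR3 : ∀ x w, Straight B T (σ x) w → B x w := fun x w hw => by simpa using hR2 _ _ hw
  have hc : ClosedShape σ B 2 2 := fun x => by
    obtain ⟨v, hv⟩ := h.exists_fork (σ (σ x))
    exact ⟨v, hv, T (σ (σ x)), hT.out hv, hTT x⟩
  have hM4 := hM.le (by omega) (by omega) hc
  have hl3 := h.three_le_pure hl
  obtain rfl : l = 3 := by omega
  obtain ⟨v, hv, w, hw, x', hx', rfl⟩ := hl.1.2 (σ (σ (σ u)))
  have hsq : ∀ x y z, B (σ (σ x)) y → B y z → B z (σ (σ x)) → B (σ x) z := by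
    intro x y z hxy hyz hzx
    by_cases hz : z = T (σ (σ x))
    · rw [hTT] at hz
      subst hz
      exact absurd hzx (h.not_fork_zpow z 2)
    · exact hR3 _ _ ⟨hz, y, hxy, hyz⟩
  have h1 : B (σ (σ u)) w := hsq _ _ _ hv hw hx'
  by_cases he : σ (σ (σ u)) = T (σ (σ u))
  · rw [hTT] at he
    have hc3 : ClosedShape σ B 3 0 := h.closedShape_of_stepWalk (x := u) he
    have h3 := h.shift_le (by omega) hc3
    have h4 := h.fork_le hl.1.1 hl.1.2
    have h5 := h.two_le_shift
    have h6 := h.two_le_fork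
    exact h.ne (by omega)
  · exact h.not_fork_zpow (σ u) 2 (hR3 _ _ ⟨he, w, h1, hx'⟩)

/-- A step of `σ` followed by two steps of `B` has no shortcut along `B`. -/
theorem no_shortcut (h : Γ.IsShiftFork σ B p q) (hT : IsApexMap B T)
    (hA : ∀ x y, B x y → ¬ B y (σ x)) {u y z : V} (hxy : B (σ u) y) (hyz : B y z) :
    ¬ B u z ∧ ∀ w, B u w → ¬ B w z := by
  by_cases hz : z = T (σ u)
  · subst hz
    refine ⟨fun hB => ?_, fun w hw hw' => ?_⟩
    · exact h.asymm _ _ (h.fork_adj (hT.mem_in hB)) (h.shift_adj u)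
    · exact h.fork_shift_left_disjoint hw (hT.mem_in hw')
  · have hR : Straight B T (σ u) z := ⟨hz, y, hxy, hyz⟩
    refine ⟨h.not_fork_of_straight hT hA hR, fun w hw hw' => ?_⟩
    by_cases hzu : z = T u
    · obtain ⟨z', hne, hz'⟩ := h.exists_ne_of_straight hT hR
        (h.coherent_shift_left (h.coherent_apex hT) (-1)) (by simpa using hzu)
      exact hne (by simpa [← hzu] using hz')
    · have hcoh := h.coherent_straight hT
      have hRu : Straight B T u z := ⟨hzu, w, hw, hw'⟩
      -- the set of straight continuations would be invariant under `σ`, but has only two elements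
      have hall : ∀ {a b}, Straight B T a b → Straight B T (σ a) b := fun {a b} hab => by
        have := h.coherent_shift_left hcoh 1 (h.twoWayDist_straight hT hRu hab) (by simpa using hR)
        simpa using this
      obtain ⟨z', hne, hz'⟩ := h.exists_other_straight hT hRu
      have hTσ : ∀ a, T (σ a) = σ (T a) := fun a => by
        refine (h.apex_unique hT fun b hb => ?_).symm
        obtain ⟨b, rfl⟩ := σ.surjective b
        exact h.fork_shift (hT.out (h.fork_shift_iff.1 hb))
      have hσR : ∀ {a b}, Straight B T (σ a) (σ b) → Straight B T a b := by
        rintro a b ⟨h1, c, h2, h3⟩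
        obtain ⟨c, rfl⟩ := σ.surjective c
        exact ⟨fun e => h1 (by rw [hTσ, e]), c, h.fork_shift_iff.1 h2, h.fork_shift_iff.1 h3⟩
      obtain ⟨z₁, rfl⟩ := σ.surjective z
      obtain ⟨z₂, rfl⟩ := σ.surjective z₁
      have h1 : Straight B T u (σ z₂) := hσR (hall hRu)
      have h2 : Straight B T u z₂ := hσR (hall h1)
      rcases h.straight_three hT hRu h1 h2 with e | e | e
      · exact h.shift_ne _ e
      · exact h.shift_shift_ne _ e
      · exact h.shift_ne _ e

include hA in
/-- No shortest closed walk with steps of `B` only contains an apex pair. -/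
theorem not_apex_of_pure (h : Γ.IsShiftFork σ B p q) (hT : IsApexMap B T) {M l : ℕ}
    (hM : IsMixedLength σ B M) (hl : IsPureLength σ B l) (hlM : l < M) {k : ℕ}
    (hk : k + 2 = l) (x : V) : ¬ StepWalk B k (T x) x := by
  intro hw
  have : Nonempty V := ⟨x⟩
  have hl3 := h.three_le_pure hl
  have key : ∀ {a b c}, B a b → B b c → StepWalk B k c a → Γ.twoWayDist a c = (2, k) := by
    intro a b c hab hbc hw
    have hac : StepWalk B 2 a c := ⟨b, hab, c, hbc, rfl⟩
    have h2 : Γ.dist a c = 2 := by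
      have hle := h.dist_le_of_stepWalk (i := 0) hac
      have h0 : Γ.dist a c ≠ 0 := fun e => by
        have := h.stronglyConnected.eq_of_dist_eq_zero e
        subst this
        exact h.asymm _ _ (h.fork_adj hab) (h.fork_adj hbc)
      have h1 : Γ.dist a c ≠ 1 := fun e => by
        rcases (h.adj_iff a c).1 (h.stronglyConnected.adj_of_dist_eq_one e) with rfl | e
        · exact hA a b hab hbc
        · have := hl.le (by omega) (h.closedShape_of_stepWalk (i := 0) (x := a)
            ((StepWalk.single e).trans hw))
          omega
      omega
    have h3 : Γ.dist c a = k := by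
      have hle := h.dist_le_of_stepWalk (i := 0) (x := c) hw
      obtain ⟨i, j, hij, -, hc⟩ := h.exists_closedShape (a := 0) hac
      rcases Nat.eq_zero_or_pos i with rfl | hi
      · have := hl.le (by omega) hc
        omega
      · have := hM.le (by omega) (by omega) hc
        omega
    simp only [twoWayDist, h2, h3]
  obtain ⟨y, hxy⟩ := h.exists_fork x
  obtain ⟨m, rfl⟩ : ∃ m, k = m + 1 := ⟨k - 1, by omega⟩
  obtain ⟨a, b, c, hab, hbc, hne, hw'⟩ := h.exists_straight_walk hT (i := 0) hxy (hT.out hxy) hw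
  have h1 := key hxy (hT.out hxy) hw
  have h2 := key hab hbc hw'
  exact hne (h.coherent_apex hT (h1.trans h2.symm) rfl)

include hA in
/-- No shortest mixed closed walk with one step of `σ` contains an apex pair. -/
theorem not_apex_of_mixed (h : Γ.IsShiftFork σ B p q) (hT : IsApexMap B T) {M : ℕ}
    (hM : IsMixedLength σ B M) {k : ℕ} (hk : k + 3 = M) (x : V) :
    ¬ StepWalk B k (σ (T x)) x := by
  intro hw
  have : Nonempty V := ⟨x⟩
  have hM4 := h.four_le_mixed hM
  have key : ∀ {u b c}, B (σ u) b → B b c → StepWalk B k (σ c) (σ u) →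
      Γ.twoWayDist u c = (3, k) := by
    intro u b c hab hbc hw
    obtain ⟨h1, h2⟩ := h.no_shortcut hT hA hab hbc
    obtain ⟨h3, h4⟩ := dist_shift_segment hA h hM hab hbc le_rfl (by omega) hw h1 h2
    simp only [twoWayDist, Prod.mk.injEq]
    omega
  obtain ⟨y, hxy⟩ := h.exists_fork x
  obtain ⟨m, rfl⟩ : ∃ m, k = m + 1 := ⟨k - 1, by omega⟩
  obtain ⟨a, b, c, hab, hbc, hne, hw'⟩ := h.exists_straight_walk hT (i := 1) hxy (hT.out hxy) hw
  obtain ⟨u, rfl⟩ := σ.surjective x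
  obtain ⟨v, rfl⟩ := σ.surjective a
  have h1 := key hxy (hT.out hxy) hw
  have h2 := key hab hbc hw'
  have := h.coherent_shift_left (h.coherent_apex hT) 1 (h1.trans h2.symm) (by simp)
  exact hne (by simpa using this)

/-- A closed walk without apex pairs is determined by its first step of `B`: the first steps are
obtained by iterating a map `nxt` on arcs. -/
theorem eq_iterate_of_not_apex (h : Γ.IsShiftFork σ B p q) (hT : IsApexMap B T)
    {nxt : V × V → V × V} (hn1 : ∀ s, (nxt s).1 = s.2)
    (hn2 : ∀ s, B s.1 s.2 → B s.2 (nxt s).2 ∧ (nxt s).2 ≠ T s.1) {i k : ℕ}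
    (hgood : ∀ x, ¬ StepWalk B k ((σ ^ i) (T x)) x) {x y : V} (hxy : B x y) :
    ∀ {a b : ℕ} {v : V}, a + b = k + 1 → StepWalk B a y v → StepWalk B b ((σ ^ i) v) x →
      v = (nxt^[a] (x, y)).2 ∧ B (nxt^[a] (x, y)).1 v ∧ StepWalk B a x (nxt^[a] (x, y)).1 := by
  intro a
  induction a with
  | zero =>
    rintro b v - rfl -
    exact ⟨rfl, hxy, rfl⟩
  | succ a ih =>
    intro b v hab hw hw'
    obtain ⟨v', hv', hv⟩ := hw.exists_last
    obtain ⟨h1, h2, h3⟩ := ih (b := b + 1) (by omega) hv' ⟨_, (h.fork_pow_iff i).2 hv, hw'⟩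
    rw [Function.iterate_succ_apply']
    generalize nxt^[a] (x, y) = s at h1 h2 h3
    subst h1
    obtain ⟨h4, h5⟩ := hn2 s h2
    have h6 : v ≠ T s.1 := by
      rintro rfl
      refine hgood s.1 ?_
      have := hw'.trans h3
      rwa [show b + a = k by omega] at this
    have h7 := hT.eq_of_out h2 hv h4 h6 h5
    rw [hn1]
    exact ⟨h7, hv, h3.trans (StepWalk.single h2)⟩

include hA in
/-- Shortest mixed closed walks have at least two steps of `σ`: if there is only one, then all
pairs of consecutive steps of `B` in the walk are straight, so that it follows a shorter closed walk
with steps of `B` only. -/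
theorem not_closedShape_one_left (h : Γ.IsShiftFork σ B p q) [Nonempty V] (hT : IsApexMap B T)
    {M : ℕ} (hM : IsMixedLength σ B M) {j : ℕ} (hj : 1 + j = M) : ¬ ClosedShape σ B 1 j := by
  intro hc
  have hF : ∀ x y z, B x y → B y z → ¬ B (σ x) z := fun x y z => h.not_fork_of_square hT
  obtain ⟨l, hlM, hl⟩ := exists_isPureLength_lt hA hF h hM
  have hl3 := h.three_le_pure hl
  have hM4 := h.four_le_mixed hM
  have hnx : ∀ s : V × V, ∃ z, B s.1 s.2 → B s.2 z ∧ z ≠ T s.1 := fun s => by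
    by_cases hs : B s.1 s.2
    · obtain ⟨z, hz, hne⟩ := h.exists_straight hT hs
      exact ⟨z, fun _ => ⟨hz, hne⟩⟩
    · exact ⟨s.1, fun e => absurd e hs⟩
  choose f hf using hnx
  obtain ⟨m, rfl⟩ : ∃ m, l = m + 2 := ⟨l - 2, by omega⟩
  obtain ⟨r, rfl⟩ : ∃ r, j = m + 2 + r := ⟨j - (m + 2), by omega⟩
  obtain ⟨x⟩ := ‹Nonempty V›
  have hc' := hc x
  rw [show m + 2 + r = (m + 1 + r) + 1 by ring] at hc'
  obtain ⟨y, hxy, hw⟩ := hc'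
  change B (σ x) y at hxy
  obtain ⟨v, hv, hvx⟩ := hw.exists_split
  have hp : StepWalk B (m + 1) y (σ x) := by
    obtain ⟨y', hy', hw'⟩ := hl.1.2 (σ x)
    exact (h.coherent_stepWalk (m + 1)).swap (h.twoWayDist_fork hy' hxy) hw'
  have h1 := (h.eq_iterate_of_not_apex hT (nxt := fun s => (s.2, f s)) (fun _ => rfl)
    (fun s => hf s) (i := 0) (not_apex_of_pure hA h hT hM hl hlM rfl) hxy (b := 0) rfl hp rfl).1
  have h2 := (h.eq_iterate_of_not_apex hT (nxt := fun s => (s.2, f s)) (fun _ => rfl)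
    (fun s => hf s) (i := 1) (k := m + r) (not_apex_of_mixed hA h hT hM (by omega)) hxy (b := r)
    (by omega) hv (by
      have := (h.stepWalk_pow_iff 1).2 hvx
      simpa using this)).1
  obtain rfl : v = σ x := h2.trans h1.symm
  cases r with
  | zero => exact h.shift_ne x hvx
  | succ r =>
    have := hM.le le_rfl (by omega) (h.closedShape_of_stepWalk (i := 1) (x := x) hvx)
    omega

include hN hA in
/-- Without twins, the thin relation is contained in the square of `B`. -/
theorem false_of_noTwins (h : Γ.IsShiftFork σ B p q) [Nonempty V] : False := by
  obtain ⟨T, hT⟩ := h.exists_isApexMap hN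
  have hF : ∀ x y z, B x y → B y z → ¬ B (σ x) z := fun x y z => h.not_fork_of_square hT
  obtain ⟨M, hM⟩ := h.exists_isMixedLength
  obtain ⟨i, j, hi, hj, hij, hc⟩ := hM.1
  rcases hi.eq_or_lt with rfl | hi
  · exact not_closedShape_one_left hA h hT hM hij hc
  obtain ⟨x⟩ := ‹Nonempty V›
  have : Nonempty V := ⟨x⟩
  have hM4 := h.four_le_mixed hM
  obtain ⟨k, y, z, hk, hxy, hyz, hw⟩ := h.exists_mixed_segment hj hij hc (σ (σ x))
  obtain ⟨hno1, hno2⟩ := h.no_shortcut hT hA hxy hyz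
  rcases exists_shortcut hA hF h hM hxy hyz hi hk hw with (hs | ⟨w, hs, hs'⟩) | hs | ⟨w, hs, hs'⟩
  · exact hno1 hs
  · exact hno2 w hs hs'
  · exact h.ne_zpow_of_common_out hN (h.shift_shift_ne x).symm hs hxy 2 rfl
  -- two steps of `σ` and a step of `B` amount to two steps of `B`, so the apex map is `σ ^ 4`
  by_cases hyT : y = T x
  · subst hyT
    exact h.not_fork_zpow x 2 (hT.mem_in hxy)
  obtain ⟨hT4, -⟩ := h.apex_eq_zpow hT (k := 2) ⟨hyT, w, hs, hs'⟩ hxy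
  have hTT : ∀ u, T u = (σ ^ 4) u := fun u => hT4 u
  by_cases hn : ∃ n, 1 ≤ n ∧ n < M ∧ ClosedShape σ B n 0
  · obtain ⟨n, hn1, hnM, hcn⟩ := hn
    have hn3 := h.shift_le hn1 hcn
    have hp2 := h.two_le_shift
    rcases (show n = 3 ∨ n = 4 ∨ 5 ≤ n by omega) with rfl | rfl | hn5
    · have h3 : (σ ^ 4) x = σ x := by
        rw [pow_succ']
        exact congrArg σ (hcn x)
      exact hA x w hs (by rw [← h3, ← hTT]; exact hT.out hs)
    · have h4 : (σ ^ 4) x = x := hcn x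
      have := hT.out hs
      rw [hTT, h4] at this
      exact h.asymm _ _ (h.fork_adj hs) (h.fork_adj this)
    · obtain ⟨m, rfl⟩ := Nat.exists_eq_add_of_le hn5
      have hc' : ClosedShape σ B (m + 1) 2 := fun u => by
        obtain ⟨v, hv⟩ := h.exists_fork ((σ ^ (m + 1)) u)
        refine ⟨v, hv, _, hT.out hv, ?_⟩
        rw [hTT, ← Equiv.Perm.mul_apply, ← pow_add, show 4 + (m + 1) = 5 + m by ring]
        exact hcn u
      have := hM.le (by omega) (by omega) hc'
      omega
  · push Not at hn
    refine h.not_fork_shift (σ x) (h.fork_of_dist hM (x := x) ?_ ?_)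
    · have hle := ((h.shift_adj x).hasPath.trans (h.shift_adj (σ x)).hasPath).dist_le
      have h0 : Γ.dist x (σ (σ x)) ≠ 0 := fun e =>
        h.shift_shift_ne x (h.stronglyConnected.eq_of_dist_eq_zero e).symm
      have h1 : Γ.dist x (σ (σ x)) ≠ 1 := fun e => by
        rcases (h.adj_iff _ _).1 (h.stronglyConnected.adj_of_dist_eq_one e) with e | e
        · exact h.shift_ne x (σ.injective e)
        · exact h.not_fork_zpow x 2 e
      omega
    · apply le_antisymm
      · obtain ⟨i, rfl⟩ := Nat.exists_eq_add_of_le' hi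
        have hcx := hc x
        rw [pow_add] at hcx
        have := h.dist_le_of_stepWalk (x := σ (σ x)) hcx
        omega
      · obtain ⟨a, b, hab, -, hc'⟩ := h.exists_closedShape (a := 2) (b := 0) (x := x)
          (z := σ (σ x)) rfl
        rcases Nat.eq_zero_or_pos b with rfl | hb
        · by_contra hlt
          exact hn (2 + a) (by omega) (by omega) hc'
        · have := hM.le (by omega) (by omega) hc'
          omega

end NotInSquare

end IsShiftFork

end Digraph

namespace Digraph

/-! ### Unfolding the digraph when the thin relation is contained in the square of the forked one -/

section Unfolding

variable {V : Type*}

/-- The vertices are the `σ`-translates of the vertices of a sequence `x`, with arcs of `B` from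
`x c` to `x (c + 1)` and to `σ (x (c - 1))`. The sequence has period `s` up to the factor `σ ^ e`,
and has no further coincidences, up to the order `n` of `σ`. -/
structure IsUnfolding (σ : Equiv.Perm V) (B : V → V → Prop) (x : ℤ → V) (n s : ℕ) (e : ℤ) :
    Prop where
  order : n = orderOf σ
  pos : 0 < s
  fork_iff : ∀ c y, B (x c) y ↔ y = x (c + 1) ∨ y = σ (x (c - 1))
  ne : ∀ c, x (c + 1) ≠ σ (x (c - 1))
  eq_iff : ∀ a a' c c' : ℤ, (σ ^ a) (x c) = (σ ^ a') (x c') ↔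
    ∃ k : ℤ, c = c' + k * s ∧ (n : ℤ) ∣ a + k * e - a'
  surj : ∀ v, ∃ a c : ℤ, v = (σ ^ a) (x c)

end Unfolding

namespace IsShiftFork

variable {V : Type*} {Γ : Digraph V} {σ : Equiv.Perm V} {B : V → V → Prop} {p q : ℕ} [Finite V]

theorem fork_back (h : Γ.IsShiftFork σ B p q) {x₀ y₀ : V} (h1 : B x₀ y₀) (h2 : B y₀ (σ x₀))
    {x y : V} (hxy : B x y) : B y (σ x) := by
  have := (h.coherent_shift_right h.coherent_fork 1).swap
  simpa using this (h.twoWayDist_fork h1 hxy) (by simpa using h2)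

/-- If `σ` is contained in the square of `B`, then the arcs of `B` out of `y` are, for each arc
`(x, y)` of `B`, the arc to `σ x` and another one; following the latter gives a sequence. -/
theorem exists_sequence (h : Γ.IsShiftFork σ B p q) [Nonempty V]
    (hback : ∀ x y, B x y → B y (σ x)) :
    ∃ x : ℤ → V, (∀ c y, B (x c) y ↔ y = x (c + 1) ∨ y = σ (x (c - 1))) ∧
      ∀ c, x (c + 1) ≠ σ (x (c - 1)) := by
  let E := {s : V × V // B s.1 s.2}
  have hex : ∀ s : E, ∃ z, B s.1.2 z ∧ z ≠ σ s.1.1 := fun s => by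
    obtain ⟨z, hz, hB, -⟩ := h.exists_other_out (hback _ _ s.2)
    exact ⟨z, hB, hz⟩
  choose f hf using hex
  let nxt : E → E := fun s => ⟨(s.1.2, f s), (hf s).1⟩
  have hinj : Function.Injective nxt := by
    intro s s' hss
    have e1 : s.1.2 = s'.1.2 := congrArg (fun t : E => t.1.1) hss
    have e2 : f s = f s' := congrArg (fun t : E => t.1.2) hss
    have h1 := hback _ _ s'.2
    rw [← e1] at h1
    rcases h.eq_or_eq_of_out (hf s).1 (hback _ _ s.2) (hf s).2 h1 with e3 | e3
    · exact absurd (e2 ▸ e3.symm) (hf s').2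
    · exact Subtype.ext (Prod.ext (σ.injective e3).symm e1)
  let φ : Equiv.Perm E := Equiv.ofBijective nxt (Finite.injective_iff_bijective.1 hinj)
  obtain ⟨x₀⟩ := ‹Nonempty V›
  obtain ⟨y₀, h0⟩ := h.exists_fork x₀
  let s₀ : E := ⟨(x₀, y₀), h0⟩
  have hstep : ∀ c : ℤ, (φ ^ (c + 1)) s₀ = nxt ((φ ^ c) s₀) := fun c => by
    rw [add_comm, zpow_add, zpow_one]
    rfl
  have hsnd : ∀ c : ℤ, ((φ ^ c) s₀).1.2 = ((φ ^ (c + 1)) s₀).1.1 := fun c => by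
    rw [hstep]
  have hB : ∀ c : ℤ, B ((φ ^ c) s₀).1.1 ((φ ^ (c + 1)) s₀).1.1 := fun c => by
    rw [← hsnd]
    exact ((φ ^ c) s₀).2
  have hne : ∀ c : ℤ, ((φ ^ (c + 1)) s₀).1.1 ≠ σ ((φ ^ (c - 1)) s₀).1.1 := fun c => by
    have := (hf ((φ ^ (c - 1)) s₀)).2
    have e : f ((φ ^ (c - 1)) s₀) = ((φ ^ (c + 1)) s₀).1.1 := by
      rw [← hsnd c]
      have := hstep (c - 1)
      rw [sub_add_cancel] at this
      rw [this]
    rwa [e] at this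
  refine ⟨fun c => ((φ ^ c) s₀).1.1, fun c y => ?_, hne⟩
  have h1 : B ((φ ^ c) s₀).1.1 (σ ((φ ^ (c - 1)) s₀).1.1) := by
    have := hback _ _ (hB (c - 1))
    rwa [sub_add_cancel] at this
  constructor
  · exact h.eq_or_eq_of_out (hB c) h1 (hne c)
  · rintro (rfl | rfl)
    exacts [hB c, h1]

theorem exists_isUnfolding (h : Γ.IsShiftFork σ B p q) [Nonempty V]
    (hback : ∀ x y, B x y → B y (σ x)) : ∃ x s e, IsUnfolding σ B x (orderOf σ) s e := by
  classical
  obtain ⟨x, hB, hne⟩ := h.exists_sequence hback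
  have hex : ∃ s : ℕ, 0 < s ∧ ∃ c e : ℤ, x (c + s) = (σ ^ e) (x c) := by
    obtain ⟨a, b, hab, he⟩ := Finite.exists_ne_map_eq_of_infinite fun c : ℕ => x c
    rcases hab.lt_or_gt with hlt | hlt
    · refine ⟨b - a, by omega, a, 0, ?_⟩
      rw [Nat.cast_sub hlt.le]
      simpa using he.symm
    · refine ⟨a - b, by omega, b, 0, ?_⟩
      rw [Nat.cast_sub hlt.le]
      simpa using he
  obtain ⟨hs0, c₀, e, hc₀⟩ := Nat.find_spec hex
  have hmin : ∀ m : ℕ, 0 < m → m < Nat.find hex → ∀ c e : ℤ, x (c + m) ≠ (σ ^ e) (x c) :=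
    fun m hm hlt c e he => Nat.find_min hex hlt ⟨hm, c, e, he⟩
  generalize Nat.find hex = s at *
  -- the coincidence propagates in both directions: it cannot reverse the direction of the sequence,
  -- as this would give a coincidence with shift `s - 2`
  have hnb : ∀ c, x (c + s) = (σ ^ e) (x c) → x (c + 1 + s) = (σ ^ e) (x (c + 1)) ∧
      x (c - 1 + s) = (σ ^ e) (x (c - 1)) := by
    intro c hc
    have hmem : ∀ y, B (x c) y → (σ ^ e) y = x (c + s + 1) ∨ (σ ^ e) y = σ (x (c + s - 1)) :=
      fun y hy => by rw [← hB, hc, h.fork_zpow_iff]; exact hy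
    have h1 := hmem _ ((hB c _).2 (Or.inl rfl))
    have h2 := hmem _ ((hB c _).2 (Or.inr rfl))
    have h3 : ¬ (σ ^ e) (x (c + 1)) = σ (x (c + s - 1)) := by
      intro hrev
      have hrev' : x (c + s - 1) = (σ ^ (e - 1)) (x (c + 1)) := by
        apply σ.injective
        rw [← hrev]
        conv_lhs => rw [← add_sub_cancel 1 e, zpow_add, zpow_one]
        rfl
      have hs : s = 1 ∨ s = 2 ∨ 2 < s := by omega
      rcases hs with rfl | rfl | hs
      · refine h.not_fork_zpow (x c) e ?_
        rw [← hc, hB]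
        exact Or.inl (by norm_num)
      · have e1 : (σ ^ (e - 1)) (x (c + 1)) = x (c + 1) := by
          rw [← hrev']
          congr 1
          push_cast
          ring
        have e2 : σ ^ e = σ := by
          have := h.zpow_eq_one e1
          rwa [zpow_sub, zpow_one, mul_inv_eq_one] at this
        refine hne (c + 1) ?_
        rw [e2] at hc
        rw [add_sub_cancel_right, ← hc]
        congr 1
        push_cast
        ring
      · refine hmin (s - 2) (by omega) (by omega) (c + 1) (e - 1) ?_
        rw [← hrev']
        congr 1
        rw [Nat.cast_sub hs.le]
        push_cast
        ring
    have h4 := h1.resolve_right h3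
    refine ⟨?_, ?_⟩
    · rw [h4]
      congr 1
      ring
    · have h5 : (σ ^ e) (σ (x (c - 1))) ≠ x (c + s + 1) := fun e5 =>
        hne c ((σ ^ e).injective (h4.trans e5.symm))
      have h6 := h2.resolve_left h5
      apply σ.injective
      rw [show c - 1 + (s : ℤ) = c + s - 1 by ring, ← h6, ← Equiv.Perm.mul_apply,
        ← Equiv.Perm.mul_apply, ← zpow_add_one, ← zpow_one_add, add_comm]
  have hper : ∀ c, x (c + s) = (σ ^ e) (x c) := by
    intro c
    have key : ∀ d : ℤ, x (c₀ + d + s) = (σ ^ e) (x (c₀ + d)) := by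
      intro d
      induction d with
      | zero => simpa using hc₀
      | succ i ih =>
        have := (hnb _ ih).1
        rwa [show c₀ + (i : ℤ) + 1 = c₀ + (i + 1) by ring] at this
      | pred i ih =>
        have := (hnb _ ih).2
        rwa [show c₀ + (-i : ℤ) - 1 = c₀ + (-i - 1) by ring] at this
    have := key (c - c₀)
    rwa [add_sub_cancel] at this
  have hperk : ∀ c k : ℤ, x (c + k * s) = (σ ^ (k * e)) (x c) := by
    intro c k
    induction k with
    | zero => simp
    | succ i ih =>
      rw [show c + ((i : ℤ) + 1) * s = c + i * s + s by ring, hper, ih, ← Equiv.Perm.mul_apply,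
        ← zpow_add]
      congr 2
      ring
    | pred i ih =>
      apply (σ ^ e).injective
      rw [← hper, show c + (-(i : ℤ) - 1) * s + s = c + -i * s by ring, ih,
        ← Equiv.Perm.mul_apply, ← zpow_add]
      congr 2
      ring
  refine ⟨x, s, e, rfl, hs0, hB, hne, fun a a' c c' => ?_, fun v => ?_⟩
  · constructor
    · intro heq
      have h1 : c = c' + (c - c') % s + (c - c') / s * s := by
        have := Int.emod_add_mul_ediv (c - c') s
        linarith
      obtain ⟨r, hr⟩ := Int.eq_ofNat_of_zero_le (Int.emod_nonneg (c - c') (b := s) (by omega))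
      have hrs : r < s := by
        have := Int.emod_lt_of_pos (c - c') (b := s) (by omega)
        omega
      rw [hr] at h1
      generalize (c - c') / s = k at h1
      subst h1
      rw [hperk, ← Equiv.Perm.mul_apply, ← zpow_add] at heq
      have h2 : x (c' + r) = (σ ^ (a' - (a + k * e))) (x c') := by
        rw [sub_eq_neg_add, zpow_add, Equiv.Perm.mul_apply, ← heq, ← Equiv.Perm.mul_apply,
          ← zpow_add]
        simp
      rcases Nat.eq_zero_or_pos r with rfl | hr0
      · refine ⟨k, by simp, ?_⟩
        rw [Nat.cast_zero, add_zero] at h2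
        rw [orderOf_dvd_iff_zpow_eq_one, ← inv_eq_one, ← zpow_neg, neg_sub]
        exact h.zpow_eq_one h2.symm
      · exact absurd h2 (hmin r hr0 hrs _ _)
    · rintro ⟨k, rfl, hd⟩
      rw [hperk, ← Equiv.Perm.mul_apply, ← zpow_add]
      rw [orderOf_dvd_iff_zpow_eq_one, zpow_sub, mul_inv_eq_one] at hd
      rw [hd]
  · refine h.mem_of_closed (S := {v | ∃ a c : ℤ, v = (σ ^ a) (x c)}) (x₀ := x 0)
      ⟨0, 0, by simp⟩ ?_ ?_ v
    · rintro _ ⟨a, c, rfl⟩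
      exact ⟨a + 1, c, by rw [add_comm, zpow_add, zpow_one]; rfl⟩
    · rintro _ ⟨a, c, rfl⟩ y hy
      obtain ⟨y, rfl⟩ := (σ ^ a).surjective y
      rw [h.fork_zpow_iff, hB] at hy
      rcases hy with rfl | rfl
      · exact ⟨a, c + 1, rfl⟩
      · exact ⟨a + 1, c - 1, by rw [zpow_add, zpow_one]; rfl⟩

end IsShiftFork

end Digraph

namespace Digraph

/-! ### Counting walks that never turn back -/

section StraightCount

variable {V : Type*} [Fintype V]

open Classical in
/-- A weighted number of walks of length `j` from `x` to `y`. In an unfolding, where the `B`-walks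
of length two that combine the two directions are the steps of `σ`, the recursion discards all
walks but those following the sequence forwards or backwards; see `straightCount_unfolding`. -/
noncomputable def straightCount (σ : Equiv.Perm V) (B : V → V → Prop) : ℕ → V → V → ℤ
  | 0, x, y => if x = y then 2 else 0
  | 1, x, y => if B x y then 1 else 0
  | j + 2, x, y => (∑ z, if B x z then straightCount σ B (j + 1) z y else 0) -
      straightCount σ B j (σ x) y

end StraightCount

namespace IsShiftFork

variable {V : Type*} {Γ : Digraph V} {σ : Equiv.Perm V} {B : V → V → Prop} {p q : ℕ}

theorem straightCount_eq [Fintype V] (h : Γ.IsShiftFork σ B p q) (j : ℕ) {x y x' y' : V}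
    (ht : Γ.twoWayDist x y = Γ.twoWayDist x' y') :
    straightCount σ B j x y = straightCount σ B j x' y' := by
  induction j using Nat.twoStepInduction generalizing x y x' y' with
  | zero =>
    simp only [straightCount]
    congr 1
    refine propext ⟨?_, ?_⟩
    · rintro rfl
      exact h.stronglyConnected.eq_of_twoWayDist ht.symm
    · rintro rfl
      exact h.stronglyConnected.eq_of_twoWayDist ht
  | one =>
    simp only [straightCount]
    congr 1
    exact propext ⟨h.coherent_fork ht, h.coherent_fork ht.symm⟩
  | more j ih1 ih2 =>
    classical
    obtain ⟨φ, hφ⟩ := h.wdr.exists_perm ht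
    simp only [straightCount]
    congr 1
    · rw [← Equiv.sum_comp φ (fun z => if B x' z then _ else _)]
      refine Finset.sum_congr rfl fun z _ => ?_
      rw [ih2 (hφ z).2]
      congr 1
      exact propext ⟨h.coherent_fork (hφ z).1.symm, h.coherent_fork (hφ z).1⟩
    · exact ih1 (by simpa using h.twoWayDist_shift_left 1 ht)

end IsShiftFork

/-! ### Distances in the unfolding -/

namespace IsUnfolding

variable {V : Type*} {σ : Equiv.Perm V} {B : V → V → Prop} {x : ℤ → V} {n s : ℕ} {e : ℤ}

/-- Only the class of `e` modulo the order of `σ` matters. -/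
theorem congr (U : IsUnfolding σ B x n s e) {e' : ℤ} (he : (n : ℤ) ∣ e - e') :
    IsUnfolding σ B x n s e' where
  order := U.order
  pos := U.pos
  fork_iff := U.fork_iff
  ne := U.ne
  eq_iff a a' c c' := by
    rw [U.eq_iff]
    refine exists_congr fun k => and_congr_right fun _ => ?_
    rw [show a + k * e - a' = a + k * e' - a' + k * (e - e') by ring]
    exact Int.dvd_add_left (he.mul_left k)
  surj := U.surj

variable {Γ : Digraph V} {p q : ℕ} [Finite V]

theorem fork_translate_iff (U : IsUnfolding σ B x n s e) (h : Γ.IsShiftFork σ B p q) (a c : ℤ)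
    (y : V) :
    B ((σ ^ a) (x c)) y ↔ y = (σ ^ a) (x (c + 1)) ∨ y = (σ ^ (a + 1)) (x (c - 1)) := by
  obtain ⟨y, rfl⟩ := (σ ^ a).surjective y
  rw [h.fork_zpow_iff, U.fork_iff, zpow_add_one, Equiv.Perm.mul_apply,
    (σ ^ a).injective.eq_iff, (σ ^ a).injective.eq_iff]

theorem stepWalk_iff (U : IsUnfolding σ B x n s e) (h : Γ.IsShiftFork σ B p q) (j : ℕ) (a c : ℤ)
    (y : V) :
    StepWalk B j ((σ ^ a) (x c)) y ↔
      ∃ u v : ℕ, u + v = j ∧ y = (σ ^ (a + v)) (x (c + u - v)) := by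
  have hcongr : ∀ {a a' c c' : ℤ}, a = a' → c = c' → (σ ^ a) (x c) = (σ ^ a') (x c') := by
    rintro a _ c _ rfl rfl
    rfl
  induction j generalizing a c with
  | zero =>
    constructor
    · rintro rfl
      exact ⟨0, 0, rfl, by simp⟩
    · rintro ⟨u, v, huv, rfl⟩
      obtain ⟨rfl, rfl⟩ : u = 0 ∧ v = 0 := by omega
      simp [StepWalk]
  | succ j ih =>
    constructor
    · rintro ⟨z, hz, hw⟩
      rcases (U.fork_translate_iff h a c z).1 hz with rfl | rfl
      · obtain ⟨u, v, rfl, rfl⟩ := (ih _ _).1 hw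
        exact ⟨u + 1, v, by omega, hcongr rfl (by push_cast; ring)⟩
      · obtain ⟨u, v, rfl, rfl⟩ := (ih _ _).1 hw
        exact ⟨u, v + 1, by omega, hcongr (by push_cast; ring) (by push_cast; ring)⟩
    · rintro ⟨u, v, huv, rfl⟩
      rcases Nat.eq_zero_or_pos u with rfl | hu
      · obtain rfl : v = j + 1 := by omega
        refine ⟨_, (U.fork_translate_iff h a c _).2 (Or.inr rfl), (ih _ _).2 ⟨0, j, by omega, ?_⟩⟩
        exact hcongr (by push_cast; ring) (by push_cast; ring)
      · obtain ⟨u, rfl⟩ : ∃ u', u = u' + 1 := ⟨u - 1, by omega⟩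
        refine ⟨_, (U.fork_translate_iff h a c _).2 (Or.inl rfl), (ih _ _).2 ⟨u, v, by omega, ?_⟩⟩
        exact hcongr rfl (by push_cast; ring)

theorem dist_le (U : IsUnfolding σ B x n s e) (h : Γ.IsShiftFork σ B p q) {a a' c c' : ℤ}
    (i u v : ℕ) (k : ℤ) (hc : c + u - v = c' + k * s) (ha : (n : ℤ) ∣ a + i + v + k * e - a') :
    Γ.dist ((σ ^ a) (x c)) ((σ ^ a') (x c')) ≤ i + u + v := by
  rw [add_assoc]
  refine h.dist_le_of_stepWalk (i := i) (j := u + v) ?_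
  rw [← zpow_natCast, ← Equiv.Perm.mul_apply, ← zpow_add, U.stepWalk_iff h]
  refine ⟨u, v, rfl, Eq.symm ?_⟩
  rw [U.eq_iff]
  exact ⟨k, hc, by rwa [add_comm (i : ℤ) a]⟩

theorem exists_dist_eq (U : IsUnfolding σ B x n s e) (h : Γ.IsShiftFork σ B p q) (a a' c c' : ℤ) :
    ∃ (i u v : ℕ) (k : ℤ), Γ.dist ((σ ^ a) (x c)) ((σ ^ a') (x c')) = i + u + v ∧
      c + u - v = c' + k * s ∧ (n : ℤ) ∣ a + i + v + k * e - a' := by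
  obtain ⟨i, j, hij, hw⟩ := h.exists_stepWalk ((σ ^ a) (x c)) ((σ ^ a') (x c'))
  rw [← zpow_natCast, ← Equiv.Perm.mul_apply, ← zpow_add, U.stepWalk_iff h] at hw
  obtain ⟨u, v, rfl, he⟩ := hw
  obtain ⟨k, h1, h2⟩ := (U.eq_iff _ _ _ _).1 he.symm
  exact ⟨i, u, v, k, by omega, h1, by rwa [add_comm (i : ℤ) a] at h2⟩

theorem straightCount_unfolding {V : Type*} [Fintype V] {σ : Equiv.Perm V} {B : V → V → Prop}
    {x : ℤ → V} {Γ : Digraph V} (U : IsUnfolding σ B x n s e) (h : Γ.IsShiftFork σ B p q) (j : ℕ)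
    (a c : ℤ) (y : V) [DecidableEq V] :
    straightCount σ B j ((σ ^ a) (x c)) y =
      (if y = (σ ^ a) (x (c + j)) then 1 else 0) +
        if y = (σ ^ (a + j)) (x (c - j)) then 1 else 0 := by
  have hne : ∀ a c : ℤ, (σ ^ a) (x (c + 1)) ≠ (σ ^ (a + 1)) (x (c - 1)) := fun a c e' => by
    rw [zpow_add_one, Equiv.Perm.mul_apply] at e'
    exact U.ne c ((σ ^ a).injective e')
  induction j using Nat.twoStepInduction generalizing a c with
  | zero =>
    simp only [straightCount, Nat.cast_zero, add_zero, sub_zero, eq_comm (a := y)]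
    split_ifs <;> rfl
  | one =>
    simp only [straightCount, U.fork_translate_iff h, Nat.cast_one]
    by_cases h1 : y = (σ ^ a) (x (c + 1))
    · have h2 : y ≠ (σ ^ (a + 1)) (x (c - 1)) := h1 ▸ hne a c
      simp [h1, hne a c]
    · simp [h1]
  | more j ih1 ih2 =>
    classical
    have hsum : (∑ z, if B ((σ ^ a) (x c)) z then straightCount σ B (j + 1) z y else 0) =
        straightCount σ B (j + 1) ((σ ^ a) (x (c + 1))) y +
          straightCount σ B (j + 1) ((σ ^ (a + 1)) (x (c - 1))) y := by
      rw [← Finset.sum_filter]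
      have : Finset.univ.filter (fun z => B ((σ ^ a) (x c)) z) =
          {(σ ^ a) (x (c + 1)), (σ ^ (a + 1)) (x (c - 1))} := by
        ext z
        simp [U.fork_translate_iff h]
      rw [this, Finset.sum_pair (hne a c)]
    simp only [straightCount]
    rw [hsum, ← Equiv.Perm.mul_apply σ, ← zpow_one_add, ih1, ih2, ih2]
    have e1 : c + 1 + ((j + 1 : ℕ) : ℤ) = c + (j + 2 : ℕ) := by push_cast; ring
    have e2 : c + 1 - ((j + 1 : ℕ) : ℤ) = c - j := by push_cast; ring
    have e3 : c - 1 + ((j + 1 : ℕ) : ℤ) = c + j := by push_cast; ring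
    have e4 : c - 1 - ((j + 1 : ℕ) : ℤ) = c - (j + 2 : ℕ) := by push_cast; ring
    have e5 : a + ((j + 1 : ℕ) : ℤ) = 1 + a + j := by push_cast; ring
    have e6 : a + 1 + ((j + 1 : ℕ) : ℤ) = a + (j + 2 : ℕ) := by push_cast; ring
    rw [e1, e2, e3, e4, e5, e6, add_comm a 1]
    ring

/-- Two vertices in the same relation to `x 0`, one of which is reached by going `j` steps
forwards: then the other is reached by going `j` steps forwards or backwards. -/
theorem eq_or_eq_of_twoWayDist (U : IsUnfolding σ B x n s e) (h : Γ.IsShiftFork σ B p q) (j : ℕ)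
    {y : V} (ht : Γ.twoWayDist (x 0) y = Γ.twoWayDist (x 0) (x j)) :
    y = x j ∨ y = (σ ^ (j : ℤ)) (x (-j)) := by
  classical
  have := Fintype.ofFinite V
  have h1 := h.straightCount_eq j ht
  have h2 := fun y => U.straightCount_unfolding h j 0 0 y
  simp only [zpow_zero, Equiv.Perm.one_apply, zero_add, zero_sub] at h2
  rw [h2, h2, if_pos rfl] at h1
  by_contra! hcon
  rw [if_neg hcon.1, if_neg hcon.2] at h1
  split_ifs at h1 <;> omega

/-! ### Arithmetic restrictions on the parameters of the unfolding -/

theorem two_le (U : IsUnfolding σ B x n s e) (h : Γ.IsShiftFork σ B p q) : 2 ≤ s := by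
  by_contra hs
  have hs1 : s = 1 := by
    have := U.pos
    omega
  refine h.not_fork_zpow (x 0) e ?_
  rw [U.fork_iff]
  left
  have := (U.eq_iff e 0 0 (0 + 1)).2 ⟨-1, by simp [hs1], by simp⟩
  simpa using this

theorem three_le_order (U : IsUnfolding σ B x n s e) (h : Γ.IsShiftFork σ B p q) : 3 ≤ n := by
  have h0 : 0 < n := U.order ▸ orderOf_pos σ
  have h1 : σ ^ n = 1 := U.order ▸ pow_orderOf_eq_one σ
  by_contra hn
  obtain rfl | rfl : n = 1 ∨ n = 2 := by omega
  · exact h.shift_ne (x 0) (Equiv.congr_fun h1 (x 0))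
  · exact h.shift_shift_ne (x 0) (Equiv.congr_fun h1 (x 0))

/-- After `s + 1` steps forwards one has passed the period by one step. Hence also the other arc of
`B` at the translate of `x 0` is reached by `s + 1` steps in one direction. -/
theorem dvd_sub (U : IsUnfolding σ B x n s e) (h : Γ.IsShiftFork σ B p q) :
    (n : ℤ) ∣ s - 2 * e := by
  have h1 : x ((s + 1 : ℕ) : ℤ) = (σ ^ e) (x 1) := by
    have := (U.eq_iff 0 e ((s + 1 : ℕ) : ℤ) 1).2 ⟨1, by push_cast; ring, by simp⟩
    simpa using this
  have ht : Γ.twoWayDist (x 0) ((σ ^ e) (σ (x (0 - 1)))) = Γ.twoWayDist (x 0) ((σ ^ e) (x (0 + 1))) :=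
    h.twoWayDist_shift_right e
      (h.twoWayDist_fork ((U.fork_iff _ _).2 (Or.inr rfl)) ((U.fork_iff _ _).2 (Or.inl rfl)))
  rw [zero_add, ← h1] at ht
  rcases U.eq_or_eq_of_twoWayDist h (s + 1) ht with e1 | e1
  · rw [h1] at e1
    exact absurd ((σ ^ e).injective e1).symm (U.ne 0)
  · rw [← Equiv.Perm.mul_apply, ← zpow_add_one, U.eq_iff] at e1
    obtain ⟨k, hk, hd⟩ := e1
    have hs : (0 : ℤ) < s := by exact_mod_cast U.pos
    have hk1 : k = 1 := by
      push_cast at hk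
      nlinarith
    subst hk1
    obtain ⟨y, hy⟩ := hd
    refine ⟨-y, ?_⟩
    push_cast at hy
    linear_combination -hy

/-- Suppose that `(s - 2 * e) / n` is odd; the class of `e` is chosen so that this quotient is `1`.
If `e ≤ 0`, then the sequence has closed walks of length `n`, as has `σ`, which makes the two types
of arcs equal. Otherwise, unless `n` divides `e - 1`, some translates of `x e` and `x (e + 1)` have
the same distances from and to `x 0`, which puts `σ (x e)` and `x (e + 1)` in the same relation to
`x 0`. -/
theorem dvd_sub_one_of_odd (U : IsUnfolding σ B x n s e) (h : Γ.IsShiftFork σ B p q)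
    (hs : (s : ℤ) = 2 * e + n) : 1 ≤ e ∧ (n : ℤ) ∣ e - 1 := by
  have : Nonempty V := ⟨x 0⟩
  have hn := U.three_le_order h
  have hcl : ∀ {i j : ℕ}, StepWalk B j ((σ ^ i) (x 0)) (x 0) → ClosedShape σ B i j :=
    h.closedShape_of_stepWalk
  have he : 1 ≤ e := by
    by_contra he
    have h1 : ClosedShape σ B n 0 := hcl <| by
      rw [U.order, pow_orderOf_eq_one]
      rfl
    have h2 : ClosedShape σ B 0 n := hcl <| by
      have := (U.stepWalk_iff h n 0 0 (x 0)).2 ⟨(n + e).toNat, (-e).toNat, by omega, ?_⟩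
      · simpa using this
      · have := (U.eq_iff (0 + ((-e).toNat : ℤ)) 0 (0 + ((n + e).toNat : ℤ) - ((-e).toNat : ℤ)) 0).2
          ⟨1, by omega, by
            rw [show 0 + ((-e).toNat : ℤ) + 1 * e - 0 = 0 by omega]
            exact dvd_zero _⟩
        simpa using this.symm
    have h3 := h.shift_le (by omega) h1
    have h4 := h.fork_le (by omega) h2
    obtain ⟨i, j, hij, hc⟩ := h.exists_closedShape_shift
    obtain ⟨i', j', hij', hc'⟩ := h.exists_closedShape_fork
    have h5 : j = 0 → n ≤ 1 + i := by
      rintro rfl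
      have hw : (σ ^ ((1 + i : ℕ) : ℤ)) (x 0) = x 0 := by
        rw [zpow_natCast]
        exact hc (x 0)
      have := orderOf_dvd_iff_zpow_eq_one.2 (h.zpow_eq_one hw)
      rw [← U.order] at this
      exact Nat.le_of_dvd (by omega) (by exact_mod_cast this)
    have h6 : i' = 0 → n ≤ 1 + j' := by
      rintro rfl
      have hw : StepWalk B (1 + j') ((σ ^ (0 : ℤ)) (x 0)) (x 0) := hc' (x 0)
      rw [U.stepWalk_iff h] at hw
      obtain ⟨u, v, huv, hx⟩ := hw
      have hx' : (σ ^ (0 + v : ℤ)) (x (0 + u - v)) = (σ ^ (0 : ℤ)) (x 0) := hx.symm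
      obtain ⟨k, hk, hd⟩ := (U.eq_iff _ _ _ _).1 hx'
      have : (n : ℤ) ∣ ((1 + j' : ℕ) : ℤ) := by
        have h7 : ((1 + j' : ℕ) : ℤ) = 2 * (0 + v + k * e - 0) + n * k := by
          rw [← huv]
          push_cast
          linear_combination hk + k * hs
        rw [h7]
        exact dvd_add (hd.mul_left 2) (dvd_mul_right _ _)
      exact Nat.le_of_dvd (by omega) (by exact_mod_cast this)
    have h7 : j ≠ 0 → q ≤ p := fun hj => by
      have := h.fork_le (by omega) hc
      omega
    have h8 : i' ≠ 0 → p ≤ q := fun hi => by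
      have := h.shift_le (by omega) hc'
      omega
    have := h.ne
    by_cases hj : j = 0
    · have := h5 hj
      by_cases hi : i' = 0
      · have := h6 hi
        omega
      · have := h8 hi
        omega
    · have := h7 hj
      by_cases hi : i' = 0
      · have := h6 hi
        omega
      · have := h8 hi
        omega
  refine ⟨he, ?_⟩
  by_contra hd
  -- `g` is the residue of `1 - e` modulo `n`
  obtain ⟨g, w, hg1, hgn, hgw⟩ : ∃ g w : ℤ, 1 ≤ g ∧ g < n ∧ g + e = 1 + n * w := by
    refine ⟨(1 - e) % n, -((1 - e) / n), ?_, Int.emod_lt_of_pos _ (by omega), ?_⟩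
    · have h0 := Int.emod_nonneg (1 - e) (b := n) (by omega)
      have h1 : (1 - e) % n ≠ 0 := fun h1 => hd <| by
        rw [← dvd_neg, neg_sub]
        exact Int.dvd_of_emod_eq_zero h1
      omega
    · have := Int.emod_add_mul_ediv (1 - e) n
      linarith
  lift e to ℕ using by omega
  lift g to ℕ using by omega
  -- the residue of a natural number is a lower bound for it
  have hmod : ∀ {z r : ℤ}, 0 ≤ z → r < n → (n : ℤ) ∣ z - r → r ≤ z := by
    rintro z r hz hr ⟨y, hy⟩
    by_contra hlt
    have : y ≤ -1 := by
      by_contra hy0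
      have : 0 ≤ (n : ℤ) * y := mul_nonneg (by omega) (by omega)
      omega
    nlinarith
  have hk : ∀ k : ℤ, k ≤ -1 ∨ k = 0 ∨ k = 1 ∨ 2 ≤ k := fun k => by omega
  have hle : ∀ {k : ℤ}, k ≤ -1 → k * s ≤ -s := fun hk => by nlinarith
  have hge : ∀ {k : ℤ}, 2 ≤ k → 2 * s ≤ k * s := fun hk => by nlinarith
  have d1 : Γ.dist (x 0) ((σ ^ (g : ℤ)) (x e)) = g + e := by
    change Γ.dist ((σ ^ (0 : ℤ)) (x 0)) _ = _
    refine le_antisymm (U.dist_le h g e 0 0 (by simp) (by simp)) ?_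
    obtain ⟨i, u, v, k, hD, hc, ha⟩ := U.exists_dist_eq h 0 g 0 e
    rw [hD]
    rcases hk k with hk | rfl | rfl | hk
    · have := hle hk
      omega
    · have := hmod (z := i + v) (r := g) (by omega) hgn (by
        convert ha using 1
        ring)
      omega
    · omega
    · have := hge hk
      omega
  have d2 : Γ.dist ((σ ^ (g : ℤ)) (x e)) (x 0) = e + n - 1 := by
    change Γ.dist _ ((σ ^ (0 : ℤ)) (x 0)) = _
    refine le_antisymm ((U.dist_le h (n - 1) 0 e 0 (by simp) ?_).trans (by omega)) ?_
    · rw [Nat.cast_sub (by omega)]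
      refine ⟨1 + w, ?_⟩
      push_cast
      linear_combination hgw
    · obtain ⟨i, u, v, k, hD, hc, ha⟩ := U.exists_dist_eq h g 0 e 0
      rw [hD]
      rcases hk k with hk | rfl | rfl | hk
      · have := hle hk
        omega
      · have := hmod (z := i + u) (r := n - 1) (by omega) (by omega) (by
          obtain ⟨y, hy⟩ := ha
          refine ⟨y - w - 1, ?_⟩
          linear_combination hy - hgw + hc)
        omega
      · omega
      · have := hge hk
        omega
  have d3 : Γ.dist (x 0) ((σ ^ ((g : ℤ) - 1)) (x (e + 1))) = g + e := by
    change Γ.dist ((σ ^ (0 : ℤ)) (x 0)) _ = _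
    refine le_antisymm ((U.dist_le h (g - 1) (e + 1) 0 0 (by simp) ?_).trans (by omega)) ?_
    · rw [Nat.cast_sub (by omega)]
      simp
    · obtain ⟨i, u, v, k, hD, hc, ha⟩ := U.exists_dist_eq h 0 (g - 1) 0 (e + 1)
      rw [hD]
      rcases hk k with hk | rfl | rfl | hk
      · have := hle hk
        omega
      · have := hmod (z := i + v) (r := g - 1) (by omega) (by omega) (by
          convert ha using 1
          ring)
        omega
      · omega
      · have := hge hk
        omega
  have d4 : Γ.dist ((σ ^ ((g : ℤ) - 1)) (x (e + 1))) (x 0) = e + n - 1 := by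
    change Γ.dist _ ((σ ^ (0 : ℤ)) (x 0)) = _
    refine le_antisymm ((U.dist_le h 0 (e + n - 1) 0 1 ?_ ?_).trans (by omega)) ?_
    · rw [Nat.cast_sub (by omega)]
      push_cast
      linear_combination -hs
    · refine ⟨w, ?_⟩
      push_cast
      linear_combination hgw
    · obtain ⟨i, u, v, k, hD, hc, ha⟩ := U.exists_dist_eq h (g - 1) 0 (e + 1) 0
      rw [hD]
      rcases hk k with hk | rfl | rfl | hk
      · have := hle hk
        omega
      · have := hmod (z := i + u) (r := n - 1) (by omega) (by omega) (by
          obtain ⟨y, hy⟩ := ha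
          refine ⟨y - w - 1, ?_⟩
          linear_combination hy - hgw + hc)
        omega
      · omega
      · have := hge hk
        omega
  have ht : Γ.twoWayDist (x 0) ((σ ^ (g : ℤ)) (x e)) =
      Γ.twoWayDist (x 0) ((σ ^ ((g : ℤ) - 1)) (x (e + 1))) := by
    rw [twoWayDist, twoWayDist, d1, d2, d3, d4]
  have ht' := h.twoWayDist_shift_right (-((g : ℤ) - 1)) ht
  rw [← Equiv.Perm.mul_apply, ← zpow_add, ← Equiv.Perm.mul_apply, ← zpow_add, neg_add_cancel,
    show -((g : ℤ) - 1) + g = 1 by ring, zpow_zero, Equiv.Perm.one_apply] at ht'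
  rw [← Nat.cast_add_one] at ht'
  rcases U.eq_or_eq_of_twoWayDist h (e + 1) ht' with e1 | e1
  · rw [← Equiv.Perm.one_apply (x ((e + 1 : ℕ) : ℤ)), ← zpow_zero σ, U.eq_iff] at e1
    obtain ⟨k, hk', -⟩ := e1
    rcases hk k with hk | rfl | rfl | hk
    · have := hle hk
      omega
    · omega
    · omega
    · have := hge hk
      omega
  · rw [U.eq_iff] at e1
    obtain ⟨k, hk', -⟩ := e1
    rcases hk k with hk | rfl | rfl | hk
    · have := hle hk
      omega
    · omega
    · omega
    · have := hge hk
      omega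

end IsUnfolding

end Digraph

namespace Digraph

/-! ### The unfolded digraphs are the digraphs `gammaDigraph` -/

namespace IsUnfolding

variable {V : Type*} {σ : Equiv.Perm V} {B : V → V → Prop} {x : ℤ → V} {n s : ℕ} {e : ℤ}
variable {Γ : Digraph V} {p q : ℕ} [Finite V]

/-- The pair `(a, c)` corresponds to `σ ^ a (x c)`. Passing from `x (s - 1)` to `x s` contributes
the factor `σ ^ e`, which has to agree with the shift by `1 - k` in `gammaDigraph`. -/
theorem isIsomorphic_gammaDigraph (U : IsUnfolding σ B x n s e) (h : Γ.IsShiftFork σ B p q)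
    {k : ℕ} (hk : (n : ℤ) ∣ k - (1 - e)) : Γ.IsIsomorphic (gammaDigraph n s k) := by
  have hn := U.three_le_order h
  have hs := U.two_le h
  have : NeZero n := ⟨by omega⟩
  have : NeZero s := ⟨by omega⟩
  have hke : (k : ZMod n) = 1 - (e : ZMod n) := by
    rw [← sub_eq_zero, ← Int.cast_natCast (R := ZMod n) k]
    have := (ZMod.intCast_zmod_eq_zero_iff_dvd _ n).2 hk
    simpa using this
  -- the vertices `σ ^ a (x c)`, where `a` is an integer modulo the order of `σ`
  let g : ZMod n → ℤ → V := fun a c => (σ ^ (a.val : ℤ)) (x c)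
  have hval : ∀ a : ZMod n, ((a.val : ℤ) : ZMod n) = a := fun a => by simp
  have hgiff : ∀ a a' c c', g a c = g a' c' ↔ ∃ k : ℤ, c = c' + k * s ∧ a + k * e = a' := by
    intro a a' c c'
    simp only [g, U.eq_iff, ← ZMod.intCast_zmod_eq_zero_iff_dvd, Int.cast_sub, Int.cast_add,
      Int.cast_mul, hval, sub_eq_zero]
  have hg : ∀ a c : ℤ, (σ ^ a) (x c) = g a c := fun a c => by
    simp only [g, U.eq_iff, ← ZMod.intCast_zmod_eq_zero_iff_dvd, Int.cast_sub, Int.cast_add,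
      Int.cast_mul, hval]
    exact ⟨0, by simp, by simp⟩
  have hadj : ∀ a c y, Γ.Adj (g a c) y ↔ y = g (a + 1) c ∨ y = g a (c + 1) ∨
      y = g (a + 1) (c - 1) := by
    intro a c y
    have h1 : ∀ c, (σ ^ ((a.val : ℤ) + 1)) (x c) = g (a + 1) c := fun c => by
      rw [hg, Int.cast_add, hval, Int.cast_one]
    have h2 : σ (g a c) = g (a + 1) c := by
      rw [← h1, add_comm, zpow_add, zpow_one]
      rfl
    rw [h.adj_iff, U.fork_translate_iff h, h1, h2]
  let f : ZMod n × ZMod s → V := fun u => g u.1 u.2.val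
  have hinj : Function.Injective f := by
    rintro ⟨a, b⟩ ⟨a', b'⟩ he
    obtain ⟨k, hb, ha⟩ := (hgiff _ _ _ _).1 he
    dsimp only at hb ha
    have hbb : b = b' := by
      have := congrArg (Int.cast (R := ZMod s)) hb
      simpa using this
    subst hbb
    have hk0 : k * s = 0 := by omega
    have hk1 : k = 0 := by
      rcases mul_eq_zero.1 hk0 with hk1 | hk1
      · exact hk1
      · omega
    subst hk1
    simpa using ha
  have hsurj : Function.Surjective f := by
    intro v
    obtain ⟨a, c, rfl⟩ := U.surj v
    refine ⟨((a + c / s * e : ℤ), c), ?_⟩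
    rw [hg]
    simp only [f, hgiff, ZMod.val_intCast]
    refine ⟨-(c / s), ?_, ?_⟩
    · have := Int.emod_add_mul_ediv c s
      linarith
    · push_cast
      ring
  have hlast : ∀ b : ZMod s, b = -1 ↔ b.val + 1 = s := by
    intro b
    rw [eq_neg_iff_add_eq_zero, ← ZMod.val_eq_zero, ZMod.val_add, ZMod.val_one'' (by omega)]
    have := b.val_lt
    constructor
    · intro h0
      exact (Nat.le_of_dvd (by omega) (Nat.dvd_of_mod_eq_zero h0)).antisymm' (by omega)
    · intro h0
      rw [h0, Nat.mod_self]
  have hnext : ∀ a b, g a (b.val + 1) = if b = -1 then f (a - k + 1, 0) else f (a, b + 1) := by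
    intro a b
    simp only [f]
    split_ifs with hb
    · rw [hgiff]
      have := (hlast b).1 hb
      refine ⟨1, by rw [ZMod.val_zero]; omega, ?_⟩
      rw [hke]
      push_cast
      ring
    · have hb' := mt (hlast b).2 hb
      have := b.val_lt
      rw [ZMod.val_add, ZMod.val_one'' (by omega), Nat.mod_eq_of_lt (by omega)]
      push_cast
      rfl
  have hprev : ∀ a b, g (a + 1) (b.val - 1) =
      if b = 0 then f (a + k, -1) else f (a + 1, b - 1) := by
    intro a b
    have h1 : ∀ c : ZMod s, b = c + 1 → c ≠ -1 → (b.val : ℤ) = c.val + 1 := by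
      rintro c rfl hc
      have hb' := mt (hlast c).2 hc
      have := c.val_lt
      rw [ZMod.val_add, ZMod.val_one'' (by omega), Nat.mod_eq_of_lt (by omega)]
      push_cast
      rfl
    simp only [f]
    split_ifs with hb
    · rw [hgiff]
      have := (hlast (-1)).1 rfl
      refine ⟨-1, by rw [hb, ZMod.val_zero]; omega, ?_⟩
      rw [hke]
      push_cast
      ring
    · rw [h1 (b - 1) (by ring) fun e0 => hb (by linear_combination e0)]
      congr 1
      ring
  let φ : ZMod n × ZMod s ≃ V := Equiv.ofBijective f ⟨hinj, hsurj⟩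
  refine ⟨RelIso.symm ⟨φ, ?_⟩⟩
  rintro ⟨a, b⟩ u
  change Γ.Adj (g a b.val) (f u) ↔ _
  rw [hadj, hnext, hprev]
  change f u = f (a + 1, b) ∨ _ ↔ _
  simp only [gammaDigraph]
  by_cases hb0 : b = 0
  · by_cases hb1 : b = -1
    · have h1 := (hlast b).1 hb1
      rw [hb0, ZMod.val_zero] at h1
      omega
    · rw [if_neg hb1, if_pos hb0, hinj.eq_iff, hinj.eq_iff, hinj.eq_iff]
      simp [hb0, hb0 ▸ hb1]
  · by_cases hb1 : b = -1
    · rw [if_neg hb0, if_pos hb1, hinj.eq_iff, hinj.eq_iff, hinj.eq_iff]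
      rw [hb1] at hb0
      simp [hb1, hb0]
      tauto
    · rw [if_neg hb0, if_neg hb1, hinj.eq_iff, hinj.eq_iff, hinj.eq_iff]
      simp [hb0, hb1]

/-- With `0 ≤ e < n`, an even quotient `(s - 2 * e) / n` gives the first family for `e = 0`, the
second for `e = 1` and the third, with `t = e`, otherwise. An odd quotient forces `e = 1` and gives
the second family again. -/
theorem exists_isIsomorphic_gammaDigraph (U : IsUnfolding σ B x n s e)
    (h : Γ.IsShiftFork σ B p q) :
    ∃ m : ℕ, 1 ≤ m ∧
      (Γ.IsIsomorphic (gammaDigraph n (2 * m * n) 1) ∨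
        Γ.IsIsomorphic (gammaDigraph n (m * n + 2) n) ∨
        ∃ t : ℕ, 2 ≤ t ∧ t ≤ n - 1 ∧
          Γ.IsIsomorphic (gammaDigraph n (2 * m * n - 2 * n + 2 * t) (n + 1 - t))) := by
  have hn := U.three_le_order h
  have hs := U.two_le h
  -- only the class of `e` modulo `n` matters
  wlog he : 0 ≤ e ∧ e < n generalizing e
  · exact this (U.congr (e' := e % n) Int.dvd_self_sub_emod)
      ⟨Int.emod_nonneg _ (by omega), Int.emod_lt_of_pos _ (by omega)⟩
  obtain ⟨he0, hen⟩ := he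
  obtain ⟨w, hw⟩ := U.dvd_sub h
  have hw0 : 0 ≤ w ∨ w = -1 := by
    by_contra! hcon
    have : w ≤ -2 := by omega
    nlinarith
  rcases Int.even_or_odd' w with ⟨r, rfl | rfl⟩
  · have hr : 0 ≤ r := by omega
    lift r to ℕ using hr
    lift e to ℕ using he0
    obtain rfl | rfl | he2 : e = 0 ∨ e = 1 ∨ 2 ≤ e := by omega
    · have hr1 : r ≠ 0 := by
        rintro rfl
        simp at hw
        omega
      refine ⟨r, by omega, Or.inl ?_⟩
      have hs' : s = 2 * r * n := by
        zify
        push_cast at hw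
        linear_combination hw
      rw [← hs']
      exact U.isIsomorphic_gammaDigraph h (by simp)
    · have hr1 : r ≠ 0 := by
        rintro rfl
        have hs2 : s = 2 := by
          push_cast at hw
          omega
        have := (U.eq_iff 0 1 (0 + 1) (0 - 1)).2 ⟨1, by simp [hs2], by simp⟩
        exact U.ne 0 (by simpa using this)
      refine ⟨2 * r, by omega, Or.inr (Or.inl ?_)⟩
      have hs' : s = 2 * r * n + 2 := by
        zify
        push_cast at hw
        linear_combination hw
      rw [← hs']
      exact U.isIsomorphic_gammaDigraph h (by simp)
    · refine ⟨r + 1, by omega, Or.inr (Or.inr ⟨e, he2, by omega, ?_⟩)⟩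
      have hs' : s = 2 * (r + 1) * n - 2 * n + 2 * e := by
        have : 2 * (r + 1) * n = 2 * r * n + 2 * n := by ring
        rw [this, Nat.add_sub_cancel]
        zify
        linear_combination hw
      rw [← hs']
      refine U.isIsomorphic_gammaDigraph h ⟨1, ?_⟩
      rw [Nat.cast_sub (by omega)]
      push_cast
      ring
  · have U' : IsUnfolding σ B x n s (e + n * r) := U.congr (by simp)
    obtain ⟨h1, h2⟩ := U'.dvd_sub_one_of_odd h (by linear_combination hw)
    have he1 : e = 1 := by
      have h3 : (n : ℤ) ∣ e - 1 := by
        rw [show e + n * r - 1 = e - 1 + n * r by ring] at h2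
        exact (Int.dvd_add_left (dvd_mul_right _ _)).1 h2
      obtain ⟨y, hy⟩ := h3
      have hy0 : y = 0 := by
        have : -1 < y := by nlinarith
        have : y < 1 := by nlinarith
        omega
      rw [hy0, mul_zero] at hy
      omega
    subst he1
    have hr : 0 ≤ r := by
      by_contra hr
      have : r ≤ -1 := by omega
      nlinarith
    lift r to ℕ using hr
    refine ⟨2 * r + 1, by omega, Or.inr (Or.inl ?_)⟩
    have hs' : s = (2 * r + 1) * n + 2 := by
      zify
      linear_combination hw
    rw [← hs']
    exact U.isIsomorphic_gammaDigraph h (by simp)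

end IsUnfolding

end Digraph

theorem theorem1p1 {V : Type*} [Finite V] (Γ : Digraph V)
    (hloopless : ∀ x : V, ¬ Γ.Adj x x)
    (hwdr : Γ.IsWeaklyDistanceRegular)
    (hvalency : Γ.HasValency 3)
    (hgirth : 2 < Γ.girth)
    (htypes : Γ.arcTypes.ncard = 2) :
    (∃ g : ℕ, (g = 3 ∨ 5 ≤ g) ∧
      Γ.IsIsomorphic (Digraph.addCayley (ZMod 4 × ZMod g) {(0, 1), (2, 1), (1, 0)})) ∨
    (∃ q m : ℕ, 3 ≤ q ∧ 1 ≤ m ∧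
      (Γ.IsIsomorphic (Digraph.gammaDigraph q (2 * m * q) 1) ∨
        Γ.IsIsomorphic (Digraph.gammaDigraph q (m * q + 2) q) ∨
        ∃ t : ℕ, 2 ≤ t ∧ t ≤ q - 1 ∧
          Γ.IsIsomorphic
            (Digraph.gammaDigraph q (2 * m * q - 2 * q + 2 * t) (q + 1 - t)))) := by
  obtain ⟨σ, B, p, q, h⟩ := Digraph.exists_isShiftFork hloopless hwdr hvalency hgirth htypes
  obtain ⟨_, x₀, -⟩ := Set.nonempty_of_ncard_ne_zero (htypes.trans_ne two_ne_zero)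
  have : Nonempty V := ⟨x₀⟩
  by_cases hA : ∀ x y, B x y → ¬ B y (σ x)
  · left
    have hN : ¬ Digraph.NoTwins B := fun hN => Digraph.IsShiftFork.false_of_noTwins hN hA h
    simp only [Digraph.NoTwins] at hN
    push Not at hN
    obtain ⟨x, x', y, y', hx, hy, h1, h2, h3, h4⟩ := hN
    obtain ⟨τ, hτ⟩ := h.exists_isTwinMap hx hy h1 h2 h3 h4
    obtain ⟨M, hM⟩ := h.exists_isMixedLength
    have hσ := h.twin_eq_shift_shift hτ hA hM
    obtain ⟨l, hlM, hl⟩ :=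
      Digraph.IsShiftFork.exists_isPureLength_lt hA (h.not_fork_of_twins hτ) h hM
    have h5 := h.three_le_pure hl
    have h6 := h.pure_ne_four hτ hσ hM hl hlM
    exact ⟨l, by omega, h.isIsomorphic_addCayley hτ x₀ hσ hM hl hlM⟩
  · right
    push Not at hA
    obtain ⟨x, y, hxy, hyx⟩ := hA
    obtain ⟨x, s, e, U⟩ := h.exists_isUnfolding fun _ _ => h.fork_back hxy hyx
    obtain ⟨m, hm, hiso⟩ := U.exists_isIsomorphic_gammaDigraph h
    exact ⟨_, m, U.three_le_order h, hm, hiso⟩
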